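/- A 4-cycle system of order \(v\) is a pair \(\Sigma=(X,\mathcal B)\), where \(|X|=v\) and \(\mathcal B\) is a set of 4-cycles (called blocks) with vertices in \(X\) whose edge sets partition the edge set of the complete graph on \(X\). A \(c\)-block-colouring of type \(s\) of \(\Sigma\) is a map \(\phi\colon\mathcal B\to\mathcal C\) to a set of colours that uses exactly \(c\) colours and is such that, for every \(x\in X\), the blocks containing \(x\) are coloured with exactly \(s\) colours. For \(v=1+8k\) write \(4k=qs+r\) with \(0\le r<s\); the colouring is equitable if, for every \(x\in X\), the \(4k\) blocks containing \(x\) are parted by their colours into \(r\) classes of cardinality \(q+1\) and \(s-r\) classes of cardinality \(q\). Let \(\Omega_s(v)\) be the set of all \(c\) such that some 4-cycle system of order \(v\) has a \(c\)-block-colouring of type \(s\). **Theorem.** Let \(k\ge 1\), let \(s\) be a positive integer dividing \(k\), and let \(v=1+8k\). Then every integer \(c\) with \(s\le c\le\left\lfloor\frac{2s^2+s}{3}\right\rfloor\) lies in \(\Omega_s(v)\). Moreover, for each such \(c\), some 4-cycle system of order \(v\) has an equitable \(c\)-block-colouring of type \(s\). -/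

import Mathlib

/-- `b` is the edge set of a `4`-cycle `(a₁, a₂, a₃, a₄)` on four distinct vertices of `X`.
A `4`-cycle is identified with its edge set, so that rotating or reflecting the vertex sequence
gives the same cycle. -/
def IsFourCycle {X : Type*} (b : Set (Sym2 X)) : Prop :=
  ∃ a₁ a₂ a₃ a₄ : X, a₁ ≠ a₂ ∧ a₁ ≠ a₃ ∧ a₁ ≠ a₄ ∧ a₂ ≠ a₃ ∧ a₂ ≠ a₄ ∧ a₃ ≠ a₄ ∧
    b = {s(a₁, a₂), s(a₂, a₃), s(a₃, a₄), s(a₄, a₁)}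

/-- A `4`-cycle system on the vertex set `X`: a set of `4`-cycles (the blocks) that partitions the
edges of the complete graph on `X`. -/
structure FourCycleSystem (X : Type*) where
  /-- The set of blocks. -/
  blocks : Set (Set (Sym2 X))
  isFourCycle : ∀ b ∈ blocks, IsFourCycle b
  existsUnique_block : ∀ x y : X, x ≠ y → ∃! b, b ∈ blocks ∧ s(x, y) ∈ b

namespace FourCycleSystem

variable {X C : Type*}

/-- The set of the blocks that contain the vertex `x`. -/
def blocksAt (S : FourCycleSystem X) (x : X) : Set S.blocks :=
  {b | ∃ e ∈ (b : Set (Sym2 X)), x ∈ e}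

/-- The block colouring `φ` uses exactly `c` colours. -/
def UsesExactly (S : FourCycleSystem X) (φ : S.blocks → C) (c : ℕ) : Prop :=
  (Set.range φ).encard = c

/-- The block colouring `φ` is of type `s`: for every vertex `x`, the blocks containing `x` are
coloured with exactly `s` colours. -/
def IsOfType (S : FourCycleSystem X) (φ : S.blocks → C) (s : ℕ) : Prop :=
  ∀ x : X, (φ '' S.blocksAt x).encard = s

/-- The number of blocks of colour `γ` that contain the vertex `x`. -/
noncomputable def colourCount (S : FourCycleSystem X) (φ : S.blocks → C) (x : X) (γ : C) : ℕ∞ :=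
  {b ∈ S.blocksAt x | φ b = γ}.encard

/-- The block colouring `φ` is equitable with respect to the division `4k = q s + r` with
remainder: for every vertex `x`, the colours on the blocks containing `x` part these blocks into
`r` classes of cardinality `q + 1` and `s - r` classes of cardinality `q`. -/
def IsEquitable (S : FourCycleSystem X) (φ : S.blocks → C) (k s : ℕ) : Prop :=
  ∀ x : X,
    (∀ γ ∈ φ '' S.blocksAt x,
      S.colourCount φ x γ = ((4 * k / s + 1 : ℕ) : ℕ∞) ∨
      S.colourCount φ x γ = ((4 * k / s : ℕ) : ℕ∞)) ∧
    {γ ∈ φ '' S.blocksAt x | S.colourCount φ x γ = ((4 * k / s + 1 : ℕ) : ℕ∞)}.encard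
      = ((4 * k % s : ℕ) : ℕ∞) ∧
    {γ ∈ φ '' S.blocksAt x | S.colourCount φ x γ = ((4 * k / s : ℕ) : ℕ∞)}.encard
      = ((s - 4 * k % s : ℕ) : ℕ∞)

/-- The colour spectrum `Ω_s(Σ)`: all `c` such that `Σ` has a `c`-block-colouring of type `s`. -/
def colourSpectrum (S : FourCycleSystem X) (s : ℕ) : Set ℕ :=
  {c | ∃ (C : Type) (φ : S.blocks → C), S.UsesExactly φ c ∧ S.IsOfType φ s}

/-- All `c` such that `Σ`, of order `1 + 8k`, has an equitable `c`-block-colouring of type `s`. -/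
def equitableSpectrum (S : FourCycleSystem X) (k s : ℕ) : Set ℕ :=
  {c | ∃ (C : Type) (φ : S.blocks → C),
    S.UsesExactly φ c ∧ S.IsOfType φ s ∧ S.IsEquitable φ k s}

end FourCycleSystem

/-- `Ω_s(v)`: the union of the spectra `Ω_s(Σ)` over all `4`-cycle systems `Σ` of order `v`. -/
def orderColourSpectrum (s v : ℕ) : Set ℕ :=
  {c | ∃ (X : Type) (_ : Finite X) (S : FourCycleSystem X),
    Nat.card X = v ∧ c ∈ S.colourSpectrum s}

/-- All `c` such that some `4`-cycle system of order `1 + 8k` has an equitable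
`c`-block-colouring of type `s`. -/
def orderEquitableSpectrum (k s : ℕ) : Set ℕ :=
  {c | ∃ (X : Type) (_ : Finite X) (S : FourCycleSystem X),
    Nat.card X = 1 + 8 * k ∧ c ∈ S.equitableSpectrum k s}

/-!
Let `m = k / s`. An edge colouring of the complete graph on `1 + 8k` vertices that is constant on
the blocks of a `4`-cycle system and in which every colour at a vertex has degree `8m` there gives
an equitable block colouring of type `s` (`FourCycleSystem.mem_spectra_of_edgeColouring`): two edges
of a block meet at each of its vertices, so each colour at a vertex has `4m = 4k / s` blocks there,
and `8k / 8m = s` colours occur.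

Apart from `c = s`, where the cyclic system coloured by runs of edge lengths does
(`self_mem_spectra`), such edge colourings come from colourings of the complete graph on `2s + 1`
vertices, one of them called infinity, in which each colour at a vertex has degree two there and
the edges at infinity lie in monochromatic triangles (`IsBaseColouring`). Replacing each vertex
other than infinity by `4m` vertices turns degree two into degree `8m`, and the resulting graph is
covered by copies of a `4`-cycle system of order `9` through infinity and by complete bipartite
graphs on `2 + 2` vertices (`gluedSystem`, `IsBaseColouring.ncard_range_mem_spectra`). If two
base colourings are given of which one refines the other, then all intermediate numbers of colours
occur (`IsBaseColouring.mem_spectra_of_coarsening`). This is used twice.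

* The triangles at infinity pair off the other `2s` vertices. Giving each two of these `s` pairs a
  colour of their own takes `s (s + 1) / 2` colours; identifying colours by a near-one-factorization
  of the complete graph of odd order `s` or `s + 1` leaves at most `s + 1` of them
  (`mem_spectra_of_lt_of_le_choose`).
* A decomposition of the complete graph on `2s + 1` vertices into triangles and at most one
  `4`-cycle has `⌊(2s² + s) / 3⌋` members, and a greedy argument colours them with `3s - 2` colours
  such that intersecting ones are coloured differently (`NearSteiner.mem_spectra`). Such
  decompositions exist (`exists_nearSteiner`): they are the Steiner triple systems of Skolem and
  Bose for `s ≡ 0, 1` modulo `3`, and come from a twisted form of Bose's construction for `s ≡ 2`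
  modulo `3`.

The two ranges overlap or are adjacent, as `3s - 2 ≤ s (s + 1) / 2 + 1`.
-/

/-! ### Edge colourings of `4`-cycle systems -/

theorem IsFourCycle.not_isDiag {X : Type*} {b : Set (Sym2 X)} (hb : IsFourCycle b)
    {e : Sym2 X} (he : e ∈ b) : ¬ e.IsDiag := by
  obtain ⟨a₁, a₂, a₃, a₄, h12, h13, h14, h23, h24, h34, rfl⟩ := hb
  rcases he with rfl | rfl | rfl | rfl <;> simp <;> tauto

theorem IsFourCycle.nonempty {X : Type*} {b : Set (Sym2 X)} (hb : IsFourCycle b) : b.Nonempty := by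
  obtain ⟨a₁, a₂, a₃, a₄, -, -, -, -, -, -, rfl⟩ := hb
  exact ⟨_, Or.inl rfl⟩

/-- A vertex of a `4`-cycle has exactly two neighbours on it. -/
theorem IsFourCycle.ncard_neighbours {X : Type*} {b : Set (Sym2 X)} (hb : IsFourCycle b)
    {x : X} (hx : ∃ e ∈ b, x ∈ e) : {z | s(x, z) ∈ b}.ncard = 2 := by
  obtain ⟨a₁, a₂, a₃, a₄, h12, h13, h14, h23, h24, h34, rfl⟩ := hb
  have key : x = a₁ ∨ x = a₂ ∨ x = a₃ ∨ x = a₄ := by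
    obtain ⟨e, he, hxe⟩ := hx
    rcases he with rfl | rfl | rfl | rfl <;> simp at hxe <;> tauto
  rw [Set.ncard_eq_two]
  rcases key with rfl | rfl | rfl | rfl
  · exact ⟨a₂, a₄, h24, by ext z; simp; grind⟩
  · exact ⟨a₁, a₃, h13, by ext z; simp; grind⟩
  · exact ⟨a₂, a₄, h24, by ext z; simp; grind⟩
  · exact ⟨a₁, a₃, h13, by ext z; simp; grind⟩

theorem IsFourCycle.image {X Y : Type*} {b : Set (Sym2 X)} (hb : IsFourCycle b) {f : X → Y}
    (hf : Function.Injective f) : IsFourCycle (Sym2.map f '' b) := by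
  obtain ⟨a₁, a₂, a₃, a₄, h12, h13, h14, h23, h24, h34, rfl⟩ := hb
  refine ⟨f a₁, f a₂, f a₃, f a₄, hf.ne h12, hf.ne h13, hf.ne h14, hf.ne h23, hf.ne h24,
    hf.ne h34, ?_⟩
  simp [Set.image_insert_eq]

/-- An edge colouring that is constant on the blocks of a `4`-cycle system and in which every
colour present at a vertex has degree `8k/s` there gives an equitable block colouring of type
`s`: at a vertex, a block of a given colour accounts for two edges of that colour. -/
theorem FourCycleSystem.mem_spectra_of_edgeColouring {X C : Type} [Finite X]
    (S : FourCycleSystem X) (κ : Sym2 X → C) {k s : ℕ} (hk : 0 < k) (hs : s ∣ k)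
    (hX : Nat.card X = 1 + 8 * k)
    (hmono : ∀ b ∈ S.blocks, ∀ e ∈ b, ∀ e' ∈ b, κ e = κ e')
    (hdeg : ∀ x y, x ≠ y → {z | z ≠ x ∧ κ s(x, z) = κ s(x, y)}.ncard = 8 * (k / s)) :
    (κ '' {e | ¬ e.IsDiag}).ncard ∈ orderColourSpectrum s (1 + 8 * k) ∧
      (κ '' {e | ¬ e.IsDiag}).ncard ∈ orderEquitableSpectrum k s := by
  classical
  have := Fintype.ofFinite X
  have : Fintype S.blocks := Fintype.ofFinite _
  obtain ⟨m, rfl⟩ := hs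
  have hs0 : 0 < s := Nat.pos_of_mul_pos_right hk
  have hm0 : 0 < m := Nat.pos_of_mul_pos_left hk
  rw [Nat.mul_div_cancel_left _ hs0] at hdeg
  let φ : S.blocks → C := fun b => κ (S.isFourCycle b b.2).nonempty.choose
  have hφ : ∀ (b : S.blocks), ∀ e ∈ (b : Set (Sym2 X)), φ b = κ e := fun b e he =>
    hmono b b.2 _ (S.isFourCycle b b.2).nonempty.choose_spec _ he
  have hblock : ∀ x y : X, x ≠ y → ∃ b : S.blocks, s(x, y) ∈ (b : Set (Sym2 X)) := fun x y h => by
    obtain ⟨b, ⟨hb, hxy⟩, -⟩ := S.existsUnique_block x y h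
    exact ⟨⟨b, hb⟩, hxy⟩
  have hne : ∀ (b : S.blocks) {x z : X}, s(x, z) ∈ (b : Set (Sym2 X)) → z ≠ x :=
    fun b x z h hzx => (S.isFourCycle b b.2).not_isDiag h (by simp [hzx])
  have huses : S.UsesExactly φ ((κ '' {e | ¬ e.IsDiag}).ncard) := by
    have : Set.range φ = κ '' {e | ¬ e.IsDiag} := by
      ext γ
      constructor
      · rintro ⟨b, rfl⟩
        obtain ⟨e, he⟩ := (S.isFourCycle b b.2).nonempty
        exact ⟨e, (S.isFourCycle b b.2).not_isDiag he, (hφ b e he).symm⟩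
      · rintro ⟨e, he, rfl⟩
        induction e using Sym2.ind with
        | _ x y =>
          obtain ⟨b, hb⟩ := hblock x y (by simpa using he)
          exact ⟨b, hφ b _ hb⟩
    rw [FourCycleSystem.UsesExactly, this, Set.Finite.cast_ncard_eq (Set.toFinite _)]
  have himage : ∀ x, φ '' S.blocksAt x = (fun y => κ s(x, y)) '' {y | y ≠ x} := by
    intro x
    ext γ
    constructor
    · rintro ⟨b, ⟨e, he, hxe⟩, rfl⟩
      obtain ⟨z, rfl⟩ := hxe
      exact ⟨z, hne b he, (hφ b _ he).symm⟩
    · rintro ⟨y, hy, rfl⟩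
      obtain ⟨b, hb⟩ := hblock x y hy.symm
      exact ⟨b, ⟨_, hb, by simp⟩, hφ b _ hb⟩
  have htype : S.IsOfType φ s := by
    intro x
    rw [himage, ← Set.Finite.cast_ncard_eq (Set.toFinite _)]
    congr 1
    have h1 := Finset.card_eq_sum_card_image (fun y => κ s(x, y)) (Finset.univ.filter (· ≠ x))
    rw [Finset.sum_const_nat (m := 8 * m)] at h1
    · rw [Finset.filter_ne', Finset.card_erase_of_mem (Finset.mem_univ _), Finset.card_univ,
        ← Nat.card_eq_fintype_card, hX, ← Finset.filter_ne'] at h1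
      rw [← Set.ncard_coe_finset] at h1
      simp only [Finset.coe_image, Finset.coe_filter, Finset.mem_univ, true_and] at h1
      have h2 : 8 * m * s = 8 * m * ((fun y => κ s(x, y)) '' {y | y ≠ x}).ncard := by
        rw [mul_comm _ (Set.ncard _), ← h1, Nat.add_sub_cancel_left]; ring
      exact (Nat.eq_of_mul_eq_mul_left (by positivity) h2).symm
    · intro γ hγ
      obtain ⟨y, hy, rfl⟩ := Finset.mem_image.1 hγ
      rw [← hdeg x y (by simpa [eq_comm] using hy), ← Set.ncard_coe_finset]
      congr 1
      ext z
      simp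
  have hcount : ∀ x, ∀ γ ∈ φ '' S.blocksAt x, S.colourCount φ x γ = ((4 * m : ℕ) : ℕ∞) := by
    intro x γ hγ
    rw [himage] at hγ
    obtain ⟨y, hy, rfl⟩ := hγ
    rw [FourCycleSystem.colourCount, ← Set.Finite.cast_ncard_eq (Set.toFinite _)]
    congr 1
    have h := Finset.card_mul_eq_card_mul
      (fun (z : X) (b : S.blocks) => s(x, z) ∈ (b : Set (Sym2 X)))
      (s := Finset.univ.filter fun z => z ≠ x ∧ κ s(x, z) = κ s(x, y))
      (t := Finset.univ.filter fun b => b ∈ S.blocksAt x ∧ φ b = κ s(x, y)) (m := 1) (n := 2)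
      (by
        intro z hz
        simp only [Finset.mem_filter, Finset.mem_univ, true_and] at hz
        obtain ⟨b, ⟨hb, hxz⟩, huniq⟩ := S.existsUnique_block x z hz.1.symm
        rw [Finset.card_eq_one]
        refine ⟨⟨b, hb⟩, ?_⟩
        ext b'
        simp only [Finset.mem_bipartiteAbove, Finset.mem_filter, Finset.mem_univ, true_and,
          Finset.mem_singleton]
        constructor
        · rintro ⟨-, h⟩
          exact Subtype.ext (huniq _ ⟨b'.2, h⟩)
        · rintro rfl
          exact ⟨⟨⟨_, hxz, by simp⟩, (hφ _ _ hxz).trans hz.2⟩, hxz⟩)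
      (by
        intro b hb
        simp only [Finset.mem_filter, Finset.mem_univ, true_and] at hb
        rw [← (S.isFourCycle b b.2).ncard_neighbours hb.1, ← Set.ncard_coe_finset]
        congr 1
        ext z
        simp only [Finset.coe_bipartiteBelow, Finset.mem_filter, Finset.mem_univ, true_and,
          Set.mem_ofPred_eq]
        exact ⟨fun h => h.2, fun h => ⟨⟨hne b h, (hφ b _ h).symm.trans hb.2⟩, h⟩⟩)
    have h8 := hdeg x y (Ne.symm hy)
    rw [← Set.ncard_coe_finset, ← Set.ncard_coe_finset] at h
    simp only [Finset.coe_filter, Finset.mem_univ, true_and] at h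
    change Set.ncard {b | b ∈ S.blocksAt x ∧ φ b = κ s(x, y)} = 4 * m
    rw [h8] at h
    omega
  have hq : 4 * (s * m) / s = 4 * m := by
    rw [show 4 * (s * m) = s * (4 * m) by ring, Nat.mul_div_cancel_left _ hs0]
  have hr : 4 * (s * m) % s = 0 := by
    rw [show 4 * (s * m) = s * (4 * m) by ring, Nat.mul_mod_right]
  have hequi : S.IsEquitable φ (s * m) s := by
    intro x
    rw [hq, hr]
    refine ⟨fun γ hγ => Or.inr (hcount x γ hγ), ?_, ?_⟩
    · rw [Nat.cast_zero, Set.encard_eq_zero, Set.eq_empty_iff_forall_notMem]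
      rintro γ ⟨hγ, h⟩
      rw [hcount x γ hγ, Nat.cast_inj] at h
      omega
    · rw [Nat.sub_zero, ← htype x]
      congr 1
      ext γ
      exact ⟨fun h => h.1, fun h => ⟨h, hcount x γ h⟩⟩
  exact ⟨⟨X, inferInstance, S, hX, C, φ, huses, htype⟩,
    ⟨X, inferInstance, S, hX, C, φ, huses, htype, hequi⟩⟩

/-! ### The cyclic system -/

/-- The distance of two residues modulo `n`, as a function of the edge joining them. -/
def circDist (n : ℕ) : Sym2 (ZMod n) → ℕ :=
  Sym2.lift ⟨fun x y => (y - x).valMinAbs.natAbs, fun x y => by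
    dsimp only
    rw [← ZMod.natAbs_valMinAbs_neg, neg_sub]⟩

theorem circDist_mk (n : ℕ) (x y : ZMod n) :
    circDist n s(x, y) = (y - x).valMinAbs.natAbs := rfl

section Cyclic

variable {k : ℕ}

theorem circDist_mk_add (x : ZMod (8 * k + 1)) {e : ℕ} (he : e ≤ 4 * k) :
    circDist (8 * k + 1) s(x, x + e) = e := by
  rw [circDist_mk, add_sub_cancel_left, ZMod.valMinAbs_natCast_of_le_half (by omega),
    Int.natAbs_natCast]

theorem two_mul_cast_ne_zero {e : ℕ} (h1 : 1 ≤ e) (he : e ≤ 4 * k) :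
    (e : ZMod (8 * k + 1)) + e ≠ 0 := by
  rw [← Nat.cast_add, Ne, ZMod.natCast_eq_zero_iff]
  intro h
  have := Nat.le_of_dvd (by omega) h
  omega

/-- Each edge is `{x, x + e}` for a unique vertex `x` and a unique distance `e`. -/
theorem mk_add_eq_mk_add_iff {x y : ZMod (8 * k + 1)} {e f : ℕ} (he1 : 1 ≤ e) (he : e ≤ 4 * k)
    (hf : f ≤ 4 * k) : s(y, y + (e : ZMod (8 * k + 1))) = s(x, x + f) ↔ e = f ∧ y = x := by
  constructor
  · intro h
    have hef : e = f := by
      rw [← circDist_mk_add y he, h, circDist_mk_add x hf]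
    subst hef
    refine ⟨rfl, ?_⟩
    rcases Sym2.eq_iff.1 h with h | ⟨h, h'⟩
    · exact h.1
    · exact absurd (by linear_combination h' - h) (two_mul_cast_ne_zero he1 he)
  · rintro ⟨rfl, rfl⟩
    rfl

theorem exists_eq_mk_add {x y : ZMod (8 * k + 1)} (h : x ≠ y) :
    ∃ (z : ZMod (8 * k + 1)) (e : ℕ), 1 ≤ e ∧ e ≤ 4 * k ∧ s(x, y) = s(z, z + e) := by
  have hle := ZMod.natAbs_valMinAbs_le (y - x)
  have hpos : 1 ≤ (y - x).valMinAbs.natAbs := by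
    rw [Nat.one_le_iff_ne_zero, Ne, Int.natAbs_eq_zero, ZMod.valMinAbs_eq_zero, sub_eq_zero]
    exact h.symm
  have hc := ZMod.coe_valMinAbs (y - x)
  rcases Int.natAbs_eq (y - x).valMinAbs with h' | h'
  · refine ⟨x, _, hpos, by omega, ?_⟩
    rw [h', Int.cast_natCast] at hc
    rw [hc, add_sub_cancel]
  · refine ⟨y, _, hpos, by omega, ?_⟩
    rw [h', Int.cast_neg, Int.cast_natCast] at hc
    rw [Sym2.eq_swap]
    congr 2
    linear_combination hc

/-- The `4`-cycle `(x, x + 4j + 1, x - 1, x - 4j - 4)`; its edges have the distances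
`4j + 1, 4j + 2, 4j + 3, 4j + 4`. -/
def cyclicBlock (k : ℕ) (x : ZMod (8 * k + 1)) (j : ℕ) : Set (Sym2 (ZMod (8 * k + 1))) :=
  {s(x, x + (4 * j + 1)), s(x + (4 * j + 1), x - 1), s(x - 1, x - (4 * j + 4)),
    s(x - (4 * j + 4), x)}

theorem cyclicBlock_eq (x : ZMod (8 * k + 1)) (j : ℕ) : cyclicBlock k x j =
    {s(x, x + (4 * j + 1 : ℕ)), s(x - 1, x - 1 + (4 * j + 2 : ℕ)),
      s(x - (4 * j + 4), x - (4 * j + 4) + (4 * j + 3 : ℕ)),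
      s(x - (4 * j + 4), x - (4 * j + 4) + (4 * j + 4 : ℕ))} := by
  rw [cyclicBlock, Sym2.eq_swap (a := x + (4 * j + 1)) (b := x - 1),
    Sym2.eq_swap (a := x - 1) (b := x - (4 * j + 4))]
  push_cast
  ring_nf

theorem mk_add_mem_cyclicBlock {x y : ZMod (8 * k + 1)} {j e : ℕ} (hj : j < k) (he1 : 1 ≤ e)
    (he : e ≤ 4 * k) : s(y, y + (e : ZMod (8 * k + 1))) ∈ cyclicBlock k x j ↔
      (e = 4 * j + 1 ∧ y = x) ∨ (e = 4 * j + 2 ∧ y = x - 1) ∨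
      (e = 4 * j + 3 ∧ y = x - (4 * j + 4)) ∨ (e = 4 * j + 4 ∧ y = x - (4 * j + 4)) := by
  rw [cyclicBlock_eq, Set.mem_insert_iff, Set.mem_insert_iff, Set.mem_insert_iff,
    Set.mem_singleton_iff, mk_add_eq_mk_add_iff he1 he (by omega),
    mk_add_eq_mk_add_iff he1 he (by omega), mk_add_eq_mk_add_iff he1 he (by omega),
    mk_add_eq_mk_add_iff he1 he (by omega)]

theorem isFourCycle_cyclicBlock (x : ZMod (8 * k + 1)) {j : ℕ} (hj : j < k) :
    IsFourCycle (cyclicBlock k x j) := by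
  have key : ∀ (a b : ZMod (8 * k + 1)) (d : ℕ), 1 ≤ d → d ≤ 8 * k → a - b = d → a ≠ b := by
    intro a b d h1 h2 h3 h
    rw [h, sub_self, eq_comm, ZMod.natCast_eq_zero_iff] at h3
    have := Nat.le_of_dvd (by omega) h3
    omega
  refine ⟨x, x + (4 * j + 1), x - 1, x - (4 * j + 4), ?_, ?_, ?_, ?_, ?_, ?_, rfl⟩
  · exact (key _ _ (4 * j + 1) (by omega) (by omega) (by push_cast; ring)).symm
  · exact key _ _ 1 (by omega) (by omega) (by push_cast; ring)
  · exact key _ _ (4 * j + 4) (by omega) (by omega) (by push_cast; ring)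
  · exact key _ _ (4 * j + 2) (by omega) (by omega) (by push_cast; ring)
  · exact key _ _ (8 * j + 5) (by omega) (by omega) (by push_cast; ring)
  · exact key _ _ (4 * j + 3) (by omega) (by omega) (by push_cast; ring)

/-- The cyclic `4`-cycle system of order `8k + 1`. -/
def cyclicSystem (k : ℕ) : FourCycleSystem (ZMod (8 * k + 1)) where
  blocks := {b | ∃ x, ∃ j < k, b = cyclicBlock k x j}
  isFourCycle := by
    rintro _ ⟨x, j, hj, rfl⟩
    exact isFourCycle_cyclicBlock x hj
  existsUnique_block := by
    intro x y hxy
    obtain ⟨z, e, he1, he, h⟩ := exists_eq_mk_add hxy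
    rw [h]
    have hj : (e - 1) / 4 < k := by omega
    have hmod : e = 4 * ((e - 1) / 4) + 1 ∨ e = 4 * ((e - 1) / 4) + 2 ∨
      e = 4 * ((e - 1) / 4) + 3 ∨ e = 4 * ((e - 1) / 4) + 4 := by omega
    generalize (e - 1) / 4 = j at hj hmod
    apply existsUnique_of_exists_of_unique
    · rcases hmod with h | h | h | h
      · exact ⟨_, ⟨z, j, hj, rfl⟩, (mk_add_mem_cyclicBlock hj he1 he).2 (by simp [h])⟩
      · exact ⟨_, ⟨z + 1, j, hj, rfl⟩, (mk_add_mem_cyclicBlock hj he1 he).2 (by simp [h])⟩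
      · exact ⟨_, ⟨z + (4 * j + 4), j, hj, rfl⟩,
          (mk_add_mem_cyclicBlock hj he1 he).2 (by simp [h])⟩
      · exact ⟨_, ⟨z + (4 * j + 4), j, hj, rfl⟩,
          (mk_add_mem_cyclicBlock hj he1 he).2 (by simp [h])⟩
    · rintro _ _ ⟨⟨x₁, j₁, hj₁, rfl⟩, h₁⟩ ⟨⟨x₂, j₂, hj₂, rfl⟩, h₂⟩
      rw [mk_add_mem_cyclicBlock hj₁ he1 he] at h₁
      rw [mk_add_mem_cyclicBlock hj₂ he1 he] at h₂
      obtain rfl : j₁ = j₂ := by omega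
      obtain rfl : x₁ = x₂ := by
        rcases h₁ with h₁ | h₁ | h₁ | h₁ <;> rcases h₂ with h₂ | h₂ | h₂ | h₂ <;>
          first
          | omega
          | linear_combination h₂.2 - h₁.2
      rfl

theorem circDist_mem_range {e : Sym2 (ZMod (8 * k + 1))} (he : ¬ e.IsDiag) :
    1 ≤ circDist (8 * k + 1) e ∧ circDist (8 * k + 1) e ≤ 4 * k := by
  induction e using Sym2.ind with
  | _ x y =>
    obtain ⟨z, e, he1, he2, h⟩ := exists_eq_mk_add (by simpa using he)
    rw [h, circDist_mk_add z he2]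
    exact ⟨he1, he2⟩

/-- Every vertex has two neighbours at each distance `1, …, 4k`. -/
theorem ncard_circDist_mem_Ioc (x : ZMod (8 * k + 1)) {a b : ℕ} (hb : b ≤ 4 * k) :
    {z | z ≠ x ∧ circDist (8 * k + 1) s(x, z) ∈ Finset.Ioc a b}.ncard = (b - a) * 2 := by
  have hset : {z | z ≠ x ∧ circDist (8 * k + 1) s(x, z) ∈ Finset.Ioc a b} =
      (fun p : ℕ × Bool => if p.2 then x + (p.1 : ZMod (8 * k + 1)) else x - p.1) ''
        (Finset.Ioc a b ×ˢ Finset.univ : Finset (ℕ × Bool)) := by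
    ext z
    simp only [Set.mem_ofPred_eq, Set.mem_image, Prod.exists, Finset.mem_coe, Finset.mem_product,
      Finset.mem_univ, and_true, Bool.exists_bool, Bool.false_eq_true, if_true, if_false]
    constructor
    · rintro ⟨hz, h⟩
      obtain ⟨w, e, he1, he2, hw⟩ := exists_eq_mk_add hz.symm
      rw [hw, circDist_mk_add w he2] at h
      rcases Sym2.eq_iff.1 hw with ⟨rfl, rfl⟩ | ⟨rfl, rfl⟩
      · exact ⟨e, Or.inr ⟨h, rfl⟩⟩
      · exact ⟨e, Or.inl ⟨h, by ring⟩⟩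
    · rintro ⟨e, ⟨he, rfl⟩ | ⟨he, rfl⟩⟩
      · have he' := Finset.mem_Ioc.1 he
        have h := circDist_mk_add (x - (e : ZMod (8 * k + 1))) (e := e) (by omega)
        rw [Sym2.eq_swap, sub_add_cancel] at h
        rw [h]
        refine ⟨fun h0 => ?_, he⟩
        rw [h0, circDist_mk, sub_self, ZMod.valMinAbs_zero] at h
        simp at h
        omega
      · have he' := Finset.mem_Ioc.1 he
        have h := circDist_mk_add x (e := e) (by omega)
        rw [h]
        refine ⟨fun h0 => ?_, he⟩
        rw [h0, circDist_mk, sub_self, ZMod.valMinAbs_zero] at h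
        simp at h
        omega
  rw [hset, Set.InjOn.ncard_image, Set.ncard_coe_finset, Finset.card_product, Nat.card_Ioc,
    Finset.card_univ, Fintype.card_bool]
  rintro ⟨e, p⟩ he ⟨f, q⟩ hf h
  have he' : a < e ∧ e ≤ b := by simpa using he
  have hf' : a < f ∧ f ≤ b := by simpa using hf
  have hdist : ∀ (e : ℕ) (p : Bool), e ≤ b →
      circDist (8 * k + 1) s(x, if p then x + (e : ZMod (8 * k + 1)) else x - e) = e := by
    intro e p heb
    cases p
    · have h := circDist_mk_add (x - (e : ZMod (8 * k + 1))) (e := e) (by omega)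
      rwa [Sym2.eq_swap, sub_add_cancel] at h
    · exact circDist_mk_add x (by omega)
  have hef : e = f := by
    rw [← hdist e p he'.2, ← hdist f q hf'.2]
    exact congrArg (fun z => circDist (8 * k + 1) s(x, z)) h
  subst hef
  have h0 := two_mul_cast_ne_zero (k := k) (e := e) (by omega) (by omega)
  cases p <;> cases q
  · rfl
  · have h' : x - (e : ZMod (8 * k + 1)) = x + e := h
    exact absurd (by linear_combination -h') h0
  · have h' : x + (e : ZMod (8 * k + 1)) = x - e := h
    exact absurd (by linear_combination h') h0
  · rfl

end Cyclic

/-- Colouring the cyclic system by runs of `4m` consecutive distances, each colour being present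
at each vertex, gives the smallest number `s` of colours. -/
theorem self_mem_spectra {k s : ℕ} (hk : 0 < k) (hs : s ∣ k) :
    s ∈ orderColourSpectrum s (1 + 8 * k) ∧ s ∈ orderEquitableSpectrum k s := by
  obtain ⟨m, rfl⟩ := hs
  have hs0 : 0 < s := Nat.pos_of_mul_pos_right hk
  have hm0 : 0 < m := Nat.pos_of_mul_pos_left hk
  have hsm : 4 * (s * m) = s * (4 * m) := by ring
  have hlt : ∀ f, 1 ≤ f → f ≤ 4 * (s * m) → (f - 1) / (4 * m) < s := by
    intro f hf1 hf2
    rw [Nat.div_lt_iff_lt_mul (by positivity)]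
    omega
  have hle : ∀ γ, γ < s → 4 * m * γ + 4 * m ≤ 4 * (s * m) := by
    intro γ hγ
    have : (γ + 1) * m ≤ s * m := Nat.mul_le_mul_right m hγ
    nlinarith
  have hrange : ((fun e => (circDist (8 * (s * m) + 1) e - 1) / (4 * m)) ''
      {e | ¬ e.IsDiag}).ncard = s := by
    have : (fun e => (circDist (8 * (s * m) + 1) e - 1) / (4 * m)) '' {e | ¬ e.IsDiag} =
        Finset.range s := by
      ext γ
      simp only [Set.mem_image, Set.mem_ofPred_eq, Finset.coe_range, Set.mem_Iio]
      constructor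
      · rintro ⟨e, he, rfl⟩
        exact hlt _ (circDist_mem_range he).1 (circDist_mem_range he).2
      · intro hγ
        have h2 := hle γ hγ
        have h3 := circDist_mk_add (k := s * m) 0 (e := 4 * m * γ + 1) (by omega)
        refine ⟨s(0, 0 + ((4 * m * γ + 1 : ℕ) : ZMod (8 * (s * m) + 1))), ?_, ?_⟩
        · intro h
          rw [Sym2.mk_isDiag_iff] at h
          rw [← h, circDist_mk] at h3
          simp at h3
        · rw [h3, Nat.add_sub_cancel, Nat.mul_div_cancel_left _ (by positivity)]
    rw [this, Set.ncard_coe_finset, Finset.card_range]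
  have := (cyclicSystem (s * m)).mem_spectra_of_edgeColouring (s := s)
    (fun e => (circDist (8 * (s * m) + 1) e - 1) / (4 * m)) hk (Dvd.intro m rfl)
    (by simp; ring) ?_ ?_
  · rwa [hrange] at this
  · have key : ∀ (x : ZMod (8 * (s * m) + 1)) (j : ℕ), j < s * m →
        ∀ e ∈ cyclicBlock (s * m) x j, (circDist (8 * (s * m) + 1) e - 1) / (4 * m) = j / m := by
      intro x j hj e he
      rw [cyclicBlock_eq] at he
      rw [← Nat.div_div_eq_div_mul]
      rcases he with rfl | rfl | rfl | rfl <;> rw [circDist_mk_add _ (by omega)] <;> congr 1 <;>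
        omega
    rintro _ ⟨x, j, hj, rfl⟩ e he e' he'
    rw [key x j hj e he, key x j hj e' he']
  · intro x y hxy
    rw [Nat.mul_div_cancel_left _ hs0]
    have hd := circDist_mem_range (e := s(x, y)) (by simpa using hxy)
    generalize circDist (8 * (s * m) + 1) s(x, y) = f at hd
    have h1 := hlt f hd.1 hd.2
    generalize (f - 1) / (4 * m) = γ at h1
    have h2 := hle γ h1
    have h3 := ncard_circDist_mem_Ioc x (a := 4 * m * γ) h2
    rw [show 8 * m = (4 * m * γ + 4 * m - 4 * m * γ) * 2 by omega, ← h3]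
    congr 1
    ext z
    simp only [Set.mem_ofPred_eq, Finset.mem_Ioc]
    refine and_congr_right fun hz => ?_
    have hp := (circDist_mem_range (e := s(x, z)) (by simpa using hz.symm)).1
    rw [Nat.div_eq_iff (by positivity), mul_comm γ]
    omega

/-! ### Gluing, and blowing up colourings of the complete graph on `2s + 1` vertices -/

theorem Sym2.mk_mem_image_map {X Y : Type*} {f : X → Y} {b : Set (Sym2 X)} {x y : Y} :
    s(x, y) ∈ Sym2.map f '' b ↔ ∃ u v, f u = x ∧ f v = y ∧ s(u, v) ∈ b := by
  constructor
  · rintro ⟨e, he, h⟩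
    induction e using Sym2.ind with
    | _ u v =>
      rcases Sym2.eq_iff.1 (h : s(f u, f v) = s(x, y)) with ⟨h1, h2⟩ | ⟨h1, h2⟩
      · exact ⟨u, v, h1, h2, he⟩
      · exact ⟨v, u, h2, h1, by rwa [Sym2.eq_swap]⟩
  · rintro ⟨u, v, rfl, rfl, h⟩
    exact ⟨_, h, rfl⟩

/-- The copy of a `4`-cycle system along a bijection of the vertex sets. -/
def FourCycleSystem.map {X Y : Type*} (S : FourCycleSystem X) (f : X ≃ Y) :
    FourCycleSystem Y where
  blocks := (fun b => Sym2.map f '' b) '' S.blocks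
  isFourCycle := by
    rintro _ ⟨b, hb, rfl⟩
    exact (S.isFourCycle b hb).image f.injective
  existsUnique_block := by
    intro x y hxy
    obtain ⟨b, ⟨hb, hxyb⟩, huniq⟩ := S.existsUnique_block (f.symm x) (f.symm y)
      (f.symm.injective.ne hxy)
    refine ⟨_, ⟨⟨b, hb, rfl⟩, Sym2.mk_mem_image_map.2 ⟨_, _, by simp, by simp, hxyb⟩⟩, ?_⟩
    rintro _ ⟨⟨b', hb', rfl⟩, h⟩
    obtain ⟨u, v, rfl, rfl, huv⟩ := Sym2.mk_mem_image_map.1 h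
    rw [huniq b' ⟨hb', by simpa using huv⟩]

section Glue

variable {I O : Type*}

/-- The `4`-cycle that alternates between the vertices `u`, `τ u` of the `i`-th copy of `O` and
the vertices `v`, `τ v` of the `j`-th one. -/
def crossBlock (τ : O → O) (i j : I) (u v : O) : Set (Sym2 (Option (I × O))) :=
  {s(some (i, u), some (j, v)), s(some (j, v), some (i, τ u)),
    s(some (i, τ u), some (j, τ v)), s(some (j, τ v), some (i, u))}

theorem crossBlock_eq_of_mem {τ : O → O} (hτ : Function.Involutive τ) {i j i' j' : I}
    {u v u' v' : O} (h : s(some (i, u), some (j, v)) ∈ crossBlock τ i' j' u' v') :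
    crossBlock τ i' j' u' v' = crossBlock τ i j u v := by
  have hτ' := fun x => hτ x
  rcases h with h | h | h | h <;> rcases Sym2.eq_iff.1 h with ⟨h1, h2⟩ | ⟨h1, h2⟩ <;>
    simp only [Option.some.injEq, Prod.mk.injEq] at h1 h2 <;>
    obtain ⟨rfl, rfl⟩ := h1 <;> obtain ⟨rfl, rfl⟩ := h2 <;>
    ext e <;> simp only [crossBlock, Set.mem_insert_iff, Set.mem_singleton_iff, hτ',
      Sym2.eq_swap (a := some (i, _)) (b := some (j, _))] <;> tauto

/-- Copies of a `4`-cycle system on `O` with a common point at infinity are glued to a `4`-cycle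
system, the edges between different copies being covered by the cycles `crossBlock`. -/
def gluedSystem (S : FourCycleSystem (Option O)) (τ : O → O) (hτ : Function.Involutive τ)
    (hne : ∀ u, τ u ≠ u) : FourCycleSystem (Option (I × O)) where
  blocks := {b | (∃ i : I, ∃ b' ∈ S.blocks, b = Sym2.map (Option.map (Prod.mk i)) '' b') ∨
    ∃ (i j : I) (u v : O), i ≠ j ∧ b = crossBlock τ i j u v}
  isFourCycle := by
    rintro b (⟨i, b', hb', rfl⟩ | ⟨i, j, u, v, hij, rfl⟩)
    · exact (S.isFourCycle b' hb').image (Option.map_injective (Prod.mk_right_injective i))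
    · refine ⟨_, _, _, _, ?_, ?_, ?_, ?_, ?_, ?_, rfl⟩ <;> simp [hij, hij.symm, (hne _).symm]
  existsUnique_block := by
    have hinj : ∀ i : I, Function.Injective (Option.map (Prod.mk i : O → I × O)) :=
      fun i => Option.map_injective (Prod.mk_right_injective i)
    -- edges inside a copy, whose index `i` is determined because one of the ends is finite
    have inner : ∀ (i : I) (u v : Option O), u ≠ v →
        ∃! b, ((∃ i : I, ∃ b' ∈ S.blocks, b = Sym2.map (Option.map (Prod.mk i)) '' b') ∨
          ∃ (i j : I) (u v : O), i ≠ j ∧ b = crossBlock τ i j u v) ∧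
          s(Option.map (Prod.mk i) u, Option.map (Prod.mk i) v) ∈ b := by
      intro i u v huv
      obtain ⟨b, ⟨hb, huvb⟩, huniq⟩ := S.existsUnique_block u v huv
      refine ⟨_, ⟨Or.inl ⟨i, b, hb, rfl⟩, ⟨_, huvb, rfl⟩⟩, ?_⟩
      rintro _ ⟨⟨i', b', hb', rfl⟩ | ⟨i', j', u', v', hij, rfl⟩, h⟩
      · obtain ⟨u', v', hu', hv', h'⟩ := Sym2.mk_mem_image_map.1 h
        have hi : i' = i := by
          cases u <;> cases v <;> cases u' <;> cases v' <;> simp_all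
        subst hi
        obtain rfl := hinj _ hu'
        obtain rfl := hinj _ hv'
        rw [huniq b' ⟨hb', h'⟩]
      · exfalso
        cases u <;> cases v <;> simp [crossBlock] at h; grind
    intro x y hxy
    match x, y, hxy with
    | none, none, h => exact absurd rfl h
    | none, some (i, v), _ => exact inner i none (some v) (by simp)
    | some (i, u), none, _ => exact inner i (some u) none (by simp)
    | some (i, u), some (j, v), h =>
      by_cases hij : i = j
      · subst hij
        exact inner i (some u) (some v) (by simpa using h)
      · refine ⟨_, ⟨Or.inr ⟨i, j, u, v, hij, rfl⟩, Or.inl rfl⟩, ?_⟩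
        rintro _ ⟨⟨i', b', hb', rfl⟩ | ⟨i', j', u', v', -, rfl⟩, h'⟩
        · obtain ⟨u', v', hu', hv', -⟩ := Sym2.mk_mem_image_map.1 h'
          cases u' <;> cases v' <;> simp_all
        · exact crossBlock_eq_of_mem hτ h'

end Glue

/-- An edge colouring of the complete graph on `F × Bool` and a point at infinity in which every
colour at a vertex has degree two, and in which the triangles `∞, (f, false), (f, true)` are
monochromatic. The colour of the edge from infinity to `a` is encoded as the
diagonal value `χ a a`. -/
structure IsBaseColouring {F C : Type*} (χ : F × Bool → F × Bool → C) : Prop where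
  symm : ∀ a b, χ a b = χ b a
  ncard_eq_two : ∀ a b, {b' | χ a b' = χ a b}.ncard = 2
  fibre : ∀ f i j, χ (f, i) (f, j) = χ (f, false) (f, false)
  fibre_inj : ∀ a b, χ a a = χ b b → a.1 = b.1

theorem IsBaseColouring.eq_diag_iff {F C : Type*} {χ : F × Bool → F × Bool → C}
    (hχ : IsBaseColouring χ) (a b : F × Bool) : χ a b = χ a a ↔ b.1 = a.1 := by
  obtain ⟨f, i⟩ := a
  obtain ⟨g, j⟩ := b
  have h := hχ.ncard_eq_two (f, i) (f, i)
  have hsub : {(f, false), (f, true)} ⊆ {b' | χ (f, i) b' = χ (f, i) (f, i)} := by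
    rintro _ (rfl | rfl) <;> exact (hχ.fibre _ _ _).trans (hχ.fibre _ _ _).symm
  have heq := Set.eq_of_subset_of_ncard_le hsub (by rw [h, Set.ncard_pair (by simp)])
    (Set.finite_of_ncard_ne_zero (by omega))
  have := Set.ext_iff.1 heq (g, j)
  simp only [Set.mem_insert_iff, Set.mem_singleton_iff, Prod.mk.injEq, Set.mem_ofPred_eq] at this
  rw [← this]
  cases j <;> simp

/-- A colouring of the complete graph on `2s + 1` vertices is blown up by replacing each vertex
except infinity by `4m` vertices. -/
theorem IsBaseColouring.ncard_range_mem_spectra {F C : Type} [Finite F]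
    {χ : F × Bool → F × Bool → C} (hχ : IsBaseColouring χ) {k s : ℕ} (hk : 0 < k) (hs : s ∣ k)
    (hF : Nat.card F = s) :
    (Set.range (Function.uncurry χ)).ncard ∈ orderColourSpectrum s (1 + 8 * k) ∧
      (Set.range (Function.uncurry χ)).ncard ∈ orderEquitableSpectrum k s := by
  classical
  obtain ⟨m, rfl⟩ := hs
  have hs0 : 0 < s := Nat.pos_of_mul_pos_right hk
  have hm0 : 0 < m := Nat.pos_of_mul_pos_left hk
  have : Nonempty F := (Nat.card_pos_iff.1 (hF ▸ hs0)).1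
  obtain ⟨f₀⟩ := this
  let pr : (F × Fin m) × (Bool × Fin 4) → F × Bool := fun p => (p.1.1, p.2.1)
  let κ₀ : Option ((F × Fin m) × (Bool × Fin 4)) → Option ((F × Fin m) × (Bool × Fin 4)) → C
    | some p, some q => χ (pr p) (pr q)
    | some p, none => χ (pr p) (pr p)
    | none, some p => χ (pr p) (pr p)
    | none, none => χ (f₀, false) (f₀, false)
  let κ : Sym2 (Option ((F × Fin m) × (Bool × Fin 4))) → C := Sym2.lift ⟨κ₀, fun x y => by
    cases x <;> cases y <;> first | rfl | exact hχ.symm _ _⟩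
  have hpt : Nonempty (ZMod (8 * 1 + 1) ≃ Option (Bool × Fin 4)) :=
    ⟨(Fintype.equivOfCardEq (by simp))⟩
  obtain ⟨e⟩ := hpt
  let S := gluedSystem (I := F × Fin m) ((cyclicSystem 1).map e) (Prod.map id (· + 2))
    (fun u => Prod.ext rfl (by simp [add_assoc])) (fun u h => by
      have := congrArg Prod.snd h
      simp at this)
  have hrange : κ '' {e | ¬ e.IsDiag} = Set.range (Function.uncurry χ) := by
    apply subset_antisymm
    · rintro _ ⟨e, -, rfl⟩
      induction e using Sym2.ind with
      | _ x y =>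
        cases x <;> cases y <;> exact ⟨(_, _), rfl⟩
    · rintro _ ⟨⟨a, b⟩, rfl⟩
      by_cases hab : a = b
      · subst hab
        exact ⟨s(none, some ((a.1, ⟨0, hm0⟩), (a.2, 0))), by simp, rfl⟩
      · refine ⟨s(some ((a.1, ⟨0, hm0⟩), (a.2, 0)), some ((b.1, ⟨0, hm0⟩), (b.2, 0))), ?_, rfl⟩
        simpa [Prod.ext_iff] using hab
  rw [← hrange]
  -- the vertices whose edge to a vertex over `a` has a given colour
  have hN : ∀ a b, {q | χ a (pr q) = χ a b}.ncard = 8 * m := by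
    intro a b
    have h : {q | χ a (pr q) = χ a b} = (Equiv.prodProdProdComm F (Fin m) Bool (Fin 4)) ⁻¹'
        ({b' | χ a b' = χ a b} ×ˢ Set.univ) := by
      ext q
      simp [pr]
    rw [h, Set.ncard_preimage_of_injective_subset_range (Equiv.injective _) (by simp),
      Set.ncard_prod, hχ.ncard_eq_two, Set.ncard_univ, Nat.card_prod]
    simp
    ring
  refine S.mem_spectra_of_edgeColouring κ hk (Dvd.intro m rfl) ?_ ?_ ?_
  · simp [hF, Nat.card_eq_fintype_card]
    ring
  · rintro b (⟨i, b, hb, rfl⟩ | ⟨i, j, u, v, hij, rfl⟩)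
    · have hconst : ∀ e ∈ b, κ (Sym2.map (Option.map (Prod.mk i)) e) =
          χ (i.1, false) (i.1, false) := by
        intro e he
        have hd := (((cyclicSystem 1).map _).isFourCycle b hb).not_isDiag he
        induction e using Sym2.ind with
        | _ u v =>
          cases u <;> cases v
          · simp at hd
          all_goals exact hχ.fibre _ _ _
      rintro _ ⟨e, he, rfl⟩ _ ⟨e', he', rfl⟩
      rw [hconst e he, hconst e' he']
    · have hconst : ∀ e ∈ crossBlock (Prod.map id (· + 2)) i j u v,
          κ e = χ (i.1, u.1) (j.1, v.1) := by
        rintro _ (rfl | rfl | rfl | rfl)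
        · rfl
        · exact hχ.symm _ _
        · rfl
        · exact hχ.symm _ _
      intro e he e' he'
      rw [hconst e he, hconst e' he']
  · rw [Nat.mul_div_cancel_left _ hs0]
    rintro (_ | p) y hxy
    · obtain _ | q := y
      · exact absurd rfl hxy
      have h : {z | z ≠ none ∧ κ s(none, z) = κ s(none, some q)} =
          some '' {q' | χ (pr q) (pr q') = χ (pr q) (pr q)} := by
        ext (_ | q')
        · simp
        · simp only [Set.mem_ofPred_eq, Set.mem_image, Option.some.injEq, exists_eq_right]
          rw [hχ.eq_diag_iff]
          constructor
          · exact fun h => hχ.fibre_inj _ _ h.2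
          · intro h
            refine ⟨by simp, ?_⟩
            have h' : χ (pr q') (pr q') = χ (pr q) (pr q) :=
              (hχ.fibre (pr q').1 _ _).trans (h ▸ (hχ.fibre (pr q).1 _ _).symm)
            exact h'
      rw [h, Set.ncard_image_of_injective _ (Option.some_injective _), hN]
    · obtain ⟨b, hb⟩ : ∃ b, κ s(some p, y) = χ (pr p) b := by
        cases y <;> exact ⟨_, rfl⟩
      rw [hb]
      by_cases hp : χ (pr p) (pr p) = χ (pr p) b
      · have h : {z | z ≠ some p ∧ κ s(some p, z) = χ (pr p) b} =
            insert none (some '' ({q | χ (pr p) (pr q) = χ (pr p) b} \ {p})) := by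
          ext (_ | z)
          · simpa using (show κ s(some p, none) = χ (pr p) b from hp)
          · simp [κ, κ₀]; tauto
        rw [h, Set.ncard_insert_of_notMem (by simp),
          Set.ncard_image_of_injective _ (Option.some_injective _),
          Set.ncard_sdiff_singleton_add_one (by exact hp), hN]
      · have h : {z | z ≠ some p ∧ κ s(some p, z) = χ (pr p) b} =
            some '' {q | χ (pr p) (pr q) = χ (pr p) b} := by
          ext (_ | z)
          · simpa using (show κ s(some p, none) ≠ χ (pr p) b from hp)
          · simp only [Set.mem_ofPred_eq, Set.mem_image, Option.some.injEq, exists_eq_right]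
            exact ⟨fun h => h.2, fun h => ⟨fun h' => hp (Option.some.inj h' ▸ h), h⟩⟩
        rw [h, Set.ncard_image_of_injective _ (Option.some_injective _), hN]

/-! ### Numbers of colours up to `s (s + 1) / 2` -/

/-- A finite partition can be refined to any number of classes. -/
theorem exists_refinement {P C : Type*} [Finite P] (g : P → C) {c : ℕ}
    (h1 : (Set.range g).ncard ≤ c) (h2 : c ≤ Nat.card P) :
    ∃ f : P → P, (Set.range f).ncard = c ∧ ∀ p q, f p = f q → g p = g q := by
  classical
  have := Fintype.ofFinite P
  choose r hr using fun γ : Set.range g => γ.2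
  have hrinj : Function.Injective r := fun γ δ h => Subtype.ext (by rw [← hr γ, ← hr δ, h])
  have hcard : (Set.range r).toFinset.card ≤ c := by
    rw [← Set.ncard_eq_toFinset_card', ← Set.image_univ, Set.ncard_image_of_injective _ hrinj,
      Set.ncard_univ, Nat.card_coe_set_eq]
    exact h1
  obtain ⟨T, hT, -, hTc⟩ := Finset.exists_subsuperset_card_eq (Finset.subset_univ _) hcard
    (by rwa [Finset.card_univ, ← Nat.card_eq_fintype_card])
  let f : P → P := fun p => if p ∈ T then p else r ⟨g p, p, rfl⟩
  have hgf : ∀ p, g (f p) = g p := by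
    intro p
    by_cases hp : p ∈ T
    · simp [f, hp]
    · simp [f, hp, hr]
  refine ⟨f, ?_, fun p q h => by rw [← hgf p, h, hgf q]⟩
  have : Set.range f = T := by
    ext p
    constructor
    · rintro ⟨q, rfl⟩
      by_cases hq : q ∈ T
      · simp [f, hq]
      · simp only [f, hq, if_false]
        exact hT (by simp)
    · intro hp
      exact ⟨p, if_pos hp⟩
  rw [this, Set.ncard_coe_finset, hTc]

/-- Colours of a base colouring may be identified as long as the colours at a common vertex,
including the vertex at infinity, stay distinct; all intermediate numbers of colours occur. -/
theorem IsBaseColouring.mem_spectra_of_coarsening {F C C' : Type} [Finite F]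
    {χ : F × Bool → F × Bool → C} (hχ : IsBaseColouring χ) {k s c : ℕ} (hk : 0 < k) (hs : s ∣ k)
    (hF : Nat.card F = s) (g : C → C')
    (hg : ∀ a b b', g (χ a b) = g (χ a b') → χ a b = χ a b')
    (hg' : ∀ a b, g (χ a a) = g (χ b b) → χ a a = χ b b)
    (h1 : (g '' Set.range (Function.uncurry χ)).ncard ≤ c)
    (h2 : c ≤ (Set.range (Function.uncurry χ)).ncard) :
    c ∈ orderColourSpectrum s (1 + 8 * k) ∧ c ∈ orderEquitableSpectrum k s := by
  obtain ⟨f, hf, hfg⟩ := exists_refinement (P := Set.range (Function.uncurry χ))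
    (fun p => g p) (c := c) (by rwa [← Set.image_eq_range]) h2
  let χ' : F × Bool → F × Bool → Set.range (Function.uncurry χ) :=
    fun a b => ⟨χ a b, (a, b), rfl⟩
  have hinj : ∀ a b b', f (χ' a b) = f (χ' a b') ↔ χ a b = χ a b' := fun a b b' =>
    ⟨fun h => hg a b b' (hfg _ _ h), fun h => congrArg f (Subtype.ext h)⟩
  have hbase : IsBaseColouring fun a b => f (χ' a b) :=
    { symm := fun a b => congrArg f (Subtype.ext (hχ.symm a b))
      ncard_eq_two := fun a b => by
        simp only [hinj]
        exact hχ.ncard_eq_two a b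
      fibre := fun x i j => congrArg f (Subtype.ext (hχ.fibre x i j))
      fibre_inj := fun a b h => hχ.fibre_inj a b (hg' a b (hfg _ _ h)) }
  have hrange : Set.range (Function.uncurry fun a b => f (χ' a b)) = Set.range f := by
    ext p
    constructor
    · rintro ⟨⟨a, b⟩, rfl⟩
      exact ⟨_, rfl⟩
    · rintro ⟨⟨_, ⟨a, b⟩, rfl⟩, rfl⟩
      exact ⟨(a, b), rfl⟩
  have := hbase.ncard_range_mem_spectra hk hs hF
  rwa [hrange, hf] at this

theorem ZMod.two_mul_injective {n : ℕ} (hn : Odd n) :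
    Function.Injective fun x : ZMod n => x + x := by
  intro x y h
  have hu : IsUnit ((2 : ℕ) : ZMod n) := by
    rw [ZMod.isUnit_iff_coprime]
    exact hn.coprime_two_left
  apply hu.mul_left_cancel
  push_cast
  linear_combination h

/-- The colours are pairs of elements of `F`, coarsened by the sum in `ZMod n`, that is, by a
near-one-factorization of the complete graph on `ZMod n`. -/
theorem mem_spectra_of_le_choose {F : Type} [Finite F] {n k s c : ℕ} (hk : 0 < k) (hs : s ∣ k)
    (hF : Nat.card F = s) (hn : Odd n) (ν : F → ZMod n) (hν : Function.Injective ν)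
    (h1 : n ≤ c) (h2 : c ≤ (s + 1).choose 2) :
    c ∈ orderColourSpectrum s (1 + 8 * k) ∧ c ∈ orderEquitableSpectrum k s := by
  classical
  have : NeZero n := ⟨hn.pos.ne'⟩
  have hpair : ∀ a b b' : F × Bool, s(a.1, b'.1) = s(a.1, b.1) ↔ b'.1 = b.1 := by
    intro a b b'
    simp only [Sym2.eq_iff]
    grind
  have hχ : IsBaseColouring fun a b : F × Bool => s(a.1, b.1) :=
    { symm := fun a b => Sym2.eq_swap
      ncard_eq_two := fun a b => by
        simp only [hpair]
        rw [show {b' : F × Bool | b'.1 = b.1} = {(b.1, false), (b.1, true)} by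
          ext ⟨f, i⟩
          cases i <;> simp]
        exact Set.ncard_pair (by simp)
      fibre := fun _ _ _ => rfl
      fibre_inj := fun a b h => by simpa using h }
  refine hχ.mem_spectra_of_coarsening hk hs hF
    (Sym2.lift ⟨fun x y => ν x + ν y, fun x y => add_comm _ _⟩) ?_ ?_ ?_ ?_
  · intro a b b' h
    rw [hν (add_left_cancel (show ν a.1 + ν b.1 = ν a.1 + ν b'.1 from h))]
  · intro a b h
    rw [hν (ZMod.two_mul_injective hn (show ν a.1 + ν a.1 = ν b.1 + ν b.1 from h))]
  · refine (Set.ncard_le_card _).trans ?_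
    rwa [Nat.card_zmod]
  · have : Set.range (Function.uncurry fun a b : F × Bool => s(a.1, b.1)) = Set.univ := by
      rw [Set.eq_univ_iff_forall]
      intro e
      induction e using Sym2.ind with
      | _ x y => exact ⟨((x, false), (y, false)), rfl⟩
    have := Fintype.ofFinite F
    rw [‹Set.range _ = _›, Set.ncard_univ, Nat.card_eq_fintype_card, Sym2.card,
      ← Nat.card_eq_fintype_card, hF]
    exact h2

theorem mem_spectra_of_lt_of_le_choose {k s c : ℕ} (hk : 0 < k) (hs : s ∣ k) (h1 : s < c)
    (h2 : c ≤ (s + 1).choose 2) :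
    c ∈ orderColourSpectrum s (1 + 8 * k) ∧ c ∈ orderEquitableSpectrum k s := by
  have hs0 : 0 < s := Nat.pos_of_dvd_of_pos hs hk
  rcases Nat.even_or_odd s with he | ho
  · have : NeZero (s + 1) := ⟨by omega⟩
    exact mem_spectra_of_le_choose hk hs (F := {x : ZMod (s + 1) // x ≠ 0})
      (by classical rw [Nat.card_eq_fintype_card, Fintype.card_subtype_compl]; simp) he.add_one _
      Subtype.val_injective h1 h2
  · have : NeZero s := ⟨hs0.ne'⟩
    exact mem_spectra_of_le_choose hk hs (F := ZMod s) (by simp) ho id Function.injective_id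
      h1.le h2

/-! ### Decompositions into triangles and at most one `4`-cycle -/

/-- A decomposition of the complete graph on `W` into triangles and at most one `4`-cycle that
avoids the vertex `o`. The triangle of an edge `x y` has the third vertex `op x y`. The edges
of the `4`-cycle are the pairs in the relation `D`; opposite vertices of the `4`-cycle form a
triangle with `o`, so that the cycle is `x, y, op o x, op o y`. -/
structure NearSteiner (W : Type) where
  op : W → W → W
  o : W
  D : W → W → Prop
  op_self : ∀ x, op x x = x
  op_comm : ∀ x y, op x y = op y x
  op_op : ∀ x y, ¬ D x y → op x (op x y) = y
  not_D_op : ∀ x y, ¬ D x y → ¬ D x (op x y)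
  D_symm : ∀ x y, D x y → D y x
  not_D_self : ∀ x, ¬ D x x
  not_D_o : ∀ x, ¬ D o x
  D_op_o : ∀ x y, D x y → D x (op o y)
  D_eq : ∀ x y x' y', D x y → D x' y' →
    ({x, y, op o x, op o y} : Set W) = {x', y', op o x', op o y'}

namespace NearSteiner

variable {W : Type} (N : NearSteiner W)

theorem op_ne_left {x y : W} (hxy : x ≠ y) (h : ¬ N.D x y) : N.op x y ≠ x := by
  intro h'
  have := N.op_op x y h
  rw [h', N.op_self] at this
  exact hxy this

theorem op_ne_right {x y : W} (hxy : x ≠ y) (h : ¬ N.D x y) : N.op x y ≠ y := by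
  rw [N.op_comm]
  exact N.op_ne_left hxy.symm fun h' => h (N.D_symm _ _ h')

theorem ne_o_of_D {x y : W} (h : N.D x y) : x ≠ N.o := by
  rintro rfl
  exact N.not_D_o _ h

theorem op_o_op_o (x : W) : N.op N.o (N.op N.o x) = x := N.op_op _ _ (N.not_D_o x)

theorem op_o_ne {x : W} (hx : x ≠ N.o) : N.op N.o x ≠ x :=
  N.op_ne_right hx.symm (N.not_D_o x)

theorem op_o_ne_o {x : W} (hx : x ≠ N.o) : N.op N.o x ≠ N.o :=
  N.op_ne_left hx.symm (N.not_D_o x)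

theorem not_D_op_o (x : W) : ¬ N.D x (N.op N.o x) := by
  intro h
  have := N.D_op_o _ _ h
  rw [N.op_o_op_o] at this
  exact N.not_D_self x this

variable [DecidableEq W]

open Classical in
/-- The vertex set of the triangle or `4`-cycle that contains the edge `x y`. -/
noncomputable def block (x y : W) : Finset W :=
  if N.D x y then {x, y, N.op N.o x, N.op N.o y} else {x, y, N.op x y}

theorem block_comm (x y : W) : N.block x y = N.block y x := by
  unfold block
  by_cases h : N.D x y
  · rw [if_pos h, if_pos (N.D_symm _ _ h)]
    ext; simp; tauto
  · rw [if_neg h, if_neg fun h' => h (N.D_symm _ _ h'), N.op_comm]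
    ext; simp; tauto

theorem left_mem_block (x y : W) : x ∈ N.block x y := by
  unfold block; split_ifs <;> simp

theorem right_mem_block (x y : W) : y ∈ N.block x y := by
  unfold block; split_ifs <;> simp

theorem card_block_of_D {x y : W} (h : N.D x y) : (N.block x y).card = 4 := by
  have h' := N.D_symm _ _ h
  have hxy : x ≠ y := by rintro rfl; exact N.not_D_self _ h
  have h1 : x ≠ N.op N.o y := by rintro rfl; exact N.not_D_op_o _ h'
  have h2 : y ≠ N.op N.o x := by rintro rfl; exact N.not_D_op_o _ h
  have h3 : N.op N.o x ≠ N.op N.o y := fun h3 => hxy (by rw [← N.op_o_op_o x, h3, N.op_o_op_o])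
  rw [block, if_pos h]
  rw [Finset.card_insert_of_notMem, Finset.card_insert_of_notMem, Finset.card_pair h3]
  · simp [h2, (N.op_o_ne (N.ne_o_of_D h')).symm]
  · simp [hxy, h1, (N.op_o_ne (N.ne_o_of_D h)).symm]

theorem card_block_of_not_D {x y : W} (hxy : x ≠ y) (h : ¬ N.D x y) :
    (N.block x y).card = 3 := by
  rw [block, if_neg h, Finset.card_eq_three]
  exact ⟨_, _, _, hxy, (N.op_ne_left hxy h).symm, (N.op_ne_right hxy h).symm, rfl⟩

theorem block_eq_block_iff {x y z : W} (hxy : x ≠ y) (hxz : x ≠ z) :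
    N.block x z = N.block x y ↔
      z = y ∨ (N.D x y ∧ z = N.op N.o y) ∨ (¬ N.D x y ∧ z = N.op x y) := by
  by_cases h : N.D x y
  · constructor
    · intro heq
      have hz : N.D x z := by
        by_contra hz
        have := N.card_block_of_not_D hxz hz
        rw [heq, N.card_block_of_D h] at this
        omega
      have hmem := N.right_mem_block x z
      rw [heq, block, if_pos h] at hmem
      have : z ≠ N.op N.o x := by rintro rfl; exact N.not_D_op_o _ hz
      simp at hmem
      tauto
    · rintro (rfl | ⟨-, rfl⟩ | ⟨h', -⟩)
      · rfl
      · rw [block, if_pos (N.D_op_o _ _ h), block, if_pos h, N.op_o_op_o]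
        ext; simp; tauto
      · exact absurd h h'
  · constructor
    · intro heq
      have hz : ¬ N.D x z := by
        intro hz
        have := N.card_block_of_D hz
        rw [heq, N.card_block_of_not_D hxy h] at this
        omega
      have hmem := N.right_mem_block x z
      rw [heq, block, if_neg h] at hmem
      simp at hmem
      tauto
    · rintro (rfl | ⟨h', -⟩ | ⟨-, rfl⟩)
      · rfl
      · exact absurd h' h
      · rw [block, if_neg (N.not_D_op _ _ h), block, if_neg h, N.op_op _ _ h]
        ext; simp; tauto

theorem block_op_o {x : W} (hx : x ≠ N.o) : N.block x (N.op N.o x) = N.block x N.o := by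
  have h : ¬ N.D x N.o := fun h => N.not_D_o _ (N.D_symm _ _ h)
  rw [N.block_eq_block_iff hx (N.op_o_ne hx).symm]
  exact Or.inr (Or.inr ⟨h, N.op_comm _ _⟩)

/-- In the block containing the edge `x y`, the vertex `x` has two neighbours. -/
theorem ncard_block_eq {x y : W} (hxy : x ≠ y) :
    {z | z ≠ x ∧ N.block x z = N.block x y}.ncard = 2 := by
  rw [Set.ncard_eq_two]
  by_cases h : N.D x y
  · have hy := N.ne_o_of_D (N.D_symm _ _ h)
    have hne : x ≠ N.op N.o y := by rintro rfl; exact N.not_D_op_o _ (N.D_symm _ _ h)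
    refine ⟨y, N.op N.o y, (N.op_o_ne hy).symm, ?_⟩
    ext z
    simp only [Set.mem_ofPred_eq, Set.mem_insert_iff, Set.mem_singleton_iff]
    constructor
    · rintro ⟨hz, h'⟩
      rw [N.block_eq_block_iff hxy hz.symm] at h'
      tauto
    · intro hz
      have hzx : z ≠ x := by rcases hz with rfl | rfl <;> [exact hxy.symm; exact hne.symm]
      rw [N.block_eq_block_iff hxy hzx.symm]
      tauto
  · refine ⟨y, N.op x y, (N.op_ne_right hxy h).symm, ?_⟩
    have hne := N.op_ne_left hxy h
    ext z
    simp only [Set.mem_ofPred_eq, Set.mem_insert_iff, Set.mem_singleton_iff]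
    constructor
    · rintro ⟨hz, h'⟩
      rw [N.block_eq_block_iff hxy hz.symm] at h'
      tauto
    · intro hz
      have hzx : z ≠ x := by rcases hz with rfl | rfl <;> [exact hxy.symm; exact hne]
      rw [N.block_eq_block_iff hxy hzx.symm]
      tauto

theorem exists_block_eq_of_mem {u v w : W} (huv : u ≠ v) (hw : w ∈ N.block u v) :
    ∃ y, w ≠ y ∧ N.block u v = N.block w y := by
  have hcases : w = u ∨ w = v ∨ (N.D u v ∧ w = N.op N.o u) ∨ (N.D u v ∧ w = N.op N.o v) ∨
      (¬ N.D u v ∧ w = N.op u v) := by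
    unfold block at hw
    split_ifs at hw <;> simp at hw <;> tauto
  rcases hcases with rfl | rfl | ⟨h, rfl⟩ | ⟨h, rfl⟩ | ⟨h, rfl⟩
  · exact ⟨v, huv, rfl⟩
  · exact ⟨u, huv.symm, N.block_comm _ _⟩
  · have hne : v ≠ N.op N.o u := by rintro rfl; exact N.not_D_op_o _ h
    refine ⟨v, hne.symm, ?_⟩
    rw [N.block_comm u, N.block_comm _ v, eq_comm, N.block_eq_block_iff huv.symm hne]
    exact Or.inr (Or.inl ⟨N.D_symm _ _ h, rfl⟩)
  · have hne : u ≠ N.op N.o v := by rintro rfl; exact N.not_D_op_o _ (N.D_symm _ _ h)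
    refine ⟨u, hne.symm, ?_⟩
    rw [N.block_comm _ u, eq_comm, N.block_eq_block_iff huv hne]
    exact Or.inr (Or.inl ⟨h, rfl⟩)
  · have hne := N.op_ne_left huv h
    refine ⟨u, hne, ?_⟩
    rw [N.block_comm _ u, eq_comm, N.block_eq_block_iff huv hne.symm]
    exact Or.inr (Or.inr ⟨h, rfl⟩)

variable [Fintype W]

/-- The vertex sets of the triangles and the `4`-cycle. -/
noncomputable def blockSet : Finset (Finset W) :=
  (Finset.univ.filter fun p : W × W => p.1 ≠ p.2).image fun p => N.block p.1 p.2

theorem mem_blockSet {B : Finset W} : B ∈ N.blockSet ↔ ∃ x y, x ≠ y ∧ N.block x y = B := by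
  simp [blockSet]

theorem card_filter_mem_blockSet {s : ℕ} (hW : Fintype.card W = 2 * s + 1) (w : W) :
    (N.blockSet.filter (w ∈ ·)).card = s := by
  have h : N.blockSet.filter (w ∈ ·) = (Finset.univ.erase w).image (N.block w) := by
    ext B
    simp only [Finset.mem_filter, mem_blockSet, Finset.mem_image, Finset.mem_erase,
      Finset.mem_univ, and_true]
    constructor
    · rintro ⟨⟨x, y, hxy, rfl⟩, hw⟩
      obtain ⟨z, hz, h⟩ := N.exists_block_eq_of_mem hxy hw
      exact ⟨z, hz.symm, h.symm⟩
    · rintro ⟨z, hz, rfl⟩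
      exact ⟨⟨w, z, hz.symm, rfl⟩, N.left_mem_block _ _⟩
  have h1 := Finset.card_eq_sum_card_image (N.block w) (Finset.univ.erase w)
  rw [Finset.sum_const_nat (m := 2), ← h, Finset.card_erase_of_mem (Finset.mem_univ _),
    Finset.card_univ, hW] at h1
  · omega
  · intro B hB
    obtain ⟨y, hy, rfl⟩ := Finset.mem_image.1 hB
    rw [← N.ncard_block_eq (Finset.ne_of_mem_erase hy).symm, ← Set.ncard_coe_finset]
    congr 1
    ext z
    simp

theorem sum_card_blockSet {s : ℕ} (hW : Fintype.card W = 2 * s + 1) :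
    ∑ B ∈ N.blockSet, B.card = (2 * s + 1) * s := by
  have h := Finset.sum_card_bipartiteAbove_eq_sum_card_bipartiteBelow
    (fun (w : W) (B : Finset W) => w ∈ B) (s := Finset.univ) (t := N.blockSet)
  have h1 : ∀ w : W, (Finset.bipartiteAbove (fun (w : W) (B : Finset W) => w ∈ B)
      N.blockSet w).card = s := fun w => N.card_filter_mem_blockSet hW w
  have h2 : ∀ B : Finset W, Finset.bipartiteBelow (fun (w : W) (B : Finset W) => w ∈ B)
      Finset.univ B = B := fun B => by ext; simp [Finset.mem_bipartiteBelow]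
  simp only [h1, h2, Finset.sum_const, Finset.card_univ, hW, smul_eq_mul] at h
  exact h.symm

/-- All blocks but one are triangles. -/
theorem exists_forall_card_eq_three (h : N.blockSet.Nonempty) :
    ∃ B₀ ∈ N.blockSet, B₀.card ≤ 4 ∧ ∀ B ∈ N.blockSet, B ≠ B₀ → B.card = 3 := by
  by_cases hD : ∃ x y, N.D x y
  · obtain ⟨x, y, hxy⟩ := hD
    have hne : x ≠ y := by rintro rfl; exact N.not_D_self _ hxy
    refine ⟨N.block x y, N.mem_blockSet.2 ⟨x, y, hne, rfl⟩, (N.card_block_of_D hxy).le, ?_⟩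
    intro B hB hB'
    obtain ⟨u, v, huv, rfl⟩ := N.mem_blockSet.1 hB
    apply N.card_block_of_not_D huv
    intro hD
    apply hB'
    have := N.D_eq _ _ _ _ hD hxy
    rw [block, block, if_pos hD, if_pos hxy]
    apply Finset.coe_injective
    simpa using this
  · push Not at hD
    have h3 : ∀ B ∈ N.blockSet, B.card = 3 := by
      intro B hB
      obtain ⟨u, v, huv, rfl⟩ := N.mem_blockSet.1 hB
      exact N.card_block_of_not_D huv (hD u v)
    obtain ⟨B₀, hB₀⟩ := h
    exact ⟨B₀, hB₀, by rw [h3 B₀ hB₀]; omega, fun B hB _ => h3 B hB⟩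

theorem le_card_blockSet {s c : ℕ} (hs : 0 < s) (hW : Fintype.card W = 2 * s + 1)
    (hc : c ≤ (2 * s ^ 2 + s) / 3) : c ≤ N.blockSet.card := by
  have hsum := N.sum_card_blockSet hW
  have hne : N.blockSet.Nonempty := by
    rw [Finset.nonempty_iff_ne_empty]
    rintro h
    rw [h, Finset.sum_empty] at hsum
    have : 0 < (2 * s + 1) * s := by positivity
    omega
  obtain ⟨B₀, hB₀, h4, h3⟩ := N.exists_forall_card_eq_three hne
  rw [← Finset.add_sum_erase _ _ hB₀, Finset.sum_const_nat (m := 3) (fun B hB =>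
    h3 B (Finset.mem_of_mem_erase hB) (Finset.ne_of_mem_erase hB)),
    Finset.card_erase_of_mem hB₀] at hsum
  have := hne.card_pos
  have h5 : (2 * s + 1) * s = 2 * s ^ 2 + s := by ring
  omega

end NearSteiner

/-- Greedy colouring: if every element of `A` is in conflict with fewer than `n` others, then `n`
colours are enough, also when an element `q` with any number of conflicts is added. -/
theorem exists_greedy_colouring {α : Type*} [DecidableEq α] (r : α → α → Prop) [DecidableRel r]
    (hr : ∀ x y, r x y → r y x) {n : ℕ} (hn : 0 < n) (q : α) (A : Finset α)
    (hA : ∀ p ∈ A, ((insert q A).filter fun p' => p' ≠ p ∧ r p p').card < n) :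
    ∃ g : α → Fin n, ∀ p ∈ insert q A, ∀ p' ∈ insert q A, p ≠ p' → r p p' → g p ≠ g p' := by
  suffices h : ∀ B ⊆ A, ∃ g : α → Fin n,
      ∀ p ∈ insert q B, ∀ p' ∈ insert q B, p ≠ p' → r p p' → g p ≠ g p' from h A subset_rfl
  intro B
  induction B using Finset.induction_on with
  | empty =>
    intro _
    refine ⟨fun _ => ⟨0, hn⟩, fun p hp p' hp' h => ?_⟩
    simp at hp hp'
    exact absurd (hp.trans hp'.symm) h
  | insert a B ha ih =>
    intro hB
    obtain ⟨g, hg⟩ := ih ((Finset.subset_insert a B).trans hB)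
    by_cases haq : a = q
    · refine ⟨g, ?_⟩
      rwa [haq, Finset.insert_idem]
    have hsub : insert q B ⊆ insert q A :=
      Finset.insert_subset_insert q ((Finset.subset_insert a B).trans hB)
    have hcard : (((insert q B).filter fun p' => p' ≠ a ∧ r a p').image g).card < n :=
      (Finset.card_image_le.trans
        (Finset.card_le_card (Finset.filter_subset_filter _ hsub))).trans_lt
        (hA a (hB (Finset.mem_insert_self a B)))
    obtain ⟨γ, -, hγ⟩ := Finset.exists_mem_notMem_of_card_lt_card
      (hcard.trans_eq (Fintype.card_fin n).symm)
    have hnew : ∀ p ∈ insert q B, p ≠ a → r a p → γ ≠ g p := fun p hp hpa hrp h =>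
      hγ (Finset.mem_image.2 ⟨p, Finset.mem_filter.2 ⟨hp, hpa, hrp⟩, h.symm⟩)
    refine ⟨Function.update g a γ, fun p hp p' hp' hne hrp => ?_⟩
    rw [Finset.insert_comm, Finset.mem_insert] at hp hp'
    by_cases h1 : p = a
    · have h2 : p' ≠ a := fun h2 => hne (h1.trans h2.symm)
      subst h1
      rw [Function.update_self, Function.update_of_ne h2]
      exact hnew p' (hp'.resolve_left h2) h2 hrp
    · rw [Function.update_of_ne h1]
      by_cases h2 : p' = a
      · subst h2
        rw [Function.update_self]
        exact (hnew p (hp.resolve_left h1) h1 (hr _ _ hrp)).symm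
      · rw [Function.update_of_ne h2]
        exact hg p (hp.resolve_left h1) p' (hp'.resolve_left h2) hne hrp

/-- The blocks of a decomposition with `s` blocks at each vertex can be coloured with `3s - 2`
colours such that intersecting blocks have distinct colours. -/
theorem NearSteiner.exists_colouring {W : Type} [DecidableEq W] [Fintype W] (N : NearSteiner W)
    {s : ℕ} (hs : 0 < s) (hW : Fintype.card W = 2 * s + 1) :
    ∃ g : Finset W → Fin (3 * s - 2), ∀ B ∈ N.blockSet, ∀ B' ∈ N.blockSet, ∀ w ∈ B, w ∈ B' →
      g B = g B' → B = B' := by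
  have hne : N.blockSet.Nonempty := by
    have := N.card_filter_mem_blockSet hW N.o
    obtain ⟨B, hB⟩ := Finset.card_pos.1 (this ▸ hs)
    exact ⟨B, (Finset.mem_filter.1 hB).1⟩
  obtain ⟨B₀, hB₀, -, h3⟩ := N.exists_forall_card_eq_three hne
  obtain ⟨g, hg⟩ := exists_greedy_colouring (fun B B' : Finset W => ¬ Disjoint B B')
    (fun B B' h h' => h h'.symm) (n := 3 * s - 2) (by omega) B₀ (N.blockSet.erase B₀) (by
      intro B hB
      rw [Finset.insert_erase hB₀]
      have hB3 := h3 B (Finset.mem_of_mem_erase hB) (Finset.ne_of_mem_erase hB)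
      have hsub : (N.blockSet.filter fun B' => B' ≠ B ∧ ¬ Disjoint B B') ⊆
          B.biUnion fun w => (N.blockSet.filter (w ∈ ·)).erase B := by
        intro B' hB'
        obtain ⟨hB'1, hB'2, hB'3⟩ := Finset.mem_filter.1 hB'
        obtain ⟨w, hw, hw'⟩ := Finset.not_disjoint_iff.1 hB'3
        exact Finset.mem_biUnion.2
          ⟨w, hw, Finset.mem_erase.2 ⟨hB'2, Finset.mem_filter.2 ⟨hB'1, hw'⟩⟩⟩
      have hle := (Finset.card_le_card hsub).trans
        (Finset.card_biUnion_le_card_mul B _ (s - 1) (fun w hw => by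
          rw [Finset.card_erase_of_mem
            (Finset.mem_filter.2 ⟨Finset.mem_of_mem_erase hB, hw⟩),
            N.card_filter_mem_blockSet hW]))
      rw [hB3] at hle
      omega)
  rw [Finset.insert_erase hB₀] at hg
  refine ⟨g, fun B hB B' hB' w hw hw' h => ?_⟩
  by_contra hBB'
  exact hg B hB B' hB' hBB' (Finset.not_disjoint_iff.2 ⟨w, hw, hw'⟩) h

/-- A fixed-point-free involution is the switch of the second coordinate on a product with
`Bool`. -/
theorem exists_equiv_prod_bool {H : Type} [Finite H] {σ : H → H} (hσ : Function.Involutive σ)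
    (hne : ∀ a, σ a ≠ a) :
    ∃ (F : Type) (e : F × Bool ≃ H), ∀ f i, e (f, !i) = σ (e (f, i)) := by
  obtain ⟨n, ⟨j⟩⟩ := Finite.exists_equiv_fin H
  have hj : ∀ a, j a < j (σ a) ∨ j (σ a) < j a := fun a =>
    lt_or_gt_of_ne fun h => hne a (j.injective h).symm
  let t : {a : H // j a < j (σ a)} × Bool → H := fun p => if p.2 then σ p.1 else p.1
  have ht : Function.Bijective t := by
    constructor
    · rintro ⟨⟨a, ha⟩, i⟩ ⟨⟨b, hb⟩, i'⟩ h
      cases i <;> cases i' <;> simp only [t, Bool.false_eq_true, if_true, if_false] at h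
      · simp [h]
      · subst h
        rw [hσ] at ha
        exact absurd ha hb.asymm
      · subst h
        rw [hσ] at hb
        exact absurd hb ha.asymm
      · simp [hσ.injective h]
    · intro a
      rcases hj a with h | h
      · exact ⟨(⟨a, h⟩, false), rfl⟩
      · exact ⟨(⟨σ a, by rwa [hσ]⟩, true), hσ a⟩
  refine ⟨_, Equiv.ofBijective t ht, fun f i => ?_⟩
  cases i
  · rfl
  · exact (hσ _).symm

/-- A decomposition of the complete graph on `2s + 1` vertices into triangles and at most one
`4`-cycle realizes all numbers of colours from `3s - 2` on. -/
theorem NearSteiner.mem_spectra {W : Type} [Fintype W] (N : NearSteiner W) {k s c : ℕ}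
    (hk : 0 < k) (hs : s ∣ k) (hW : Fintype.card W = 2 * s + 1) (h1 : 3 * s - 2 ≤ c)
    (h2 : c ≤ (2 * s ^ 2 + s) / 3) :
    c ∈ orderColourSpectrum s (1 + 8 * k) ∧ c ∈ orderEquitableSpectrum k s := by
  classical
  have hs0 : 0 < s := Nat.pos_of_dvd_of_pos hs hk
  obtain ⟨g, hg⟩ := N.exists_colouring hs0 hW
  obtain ⟨F, e, he⟩ := exists_equiv_prod_bool (H := {w : W // w ≠ N.o})
    (σ := fun a => ⟨N.op N.o a, N.op_o_ne_o a.2⟩) (fun a => Subtype.ext (N.op_o_op_o a))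
    (fun a h => N.op_o_ne a.2 (congrArg Subtype.val h))
  have : Finite (F × Bool) := Finite.of_equiv _ e.symm
  have : Finite F := Finite.of_injective (fun f => (f, false)) fun f f' h => by simpa using h
  have hF : Nat.card F = s := by
    have h := Nat.card_congr e
    rw [Nat.card_prod, Nat.card_eq_fintype_card (α := Bool), Fintype.card_bool,
      Nat.card_eq_fintype_card (α := {w : W // w ≠ N.o}), Fintype.card_subtype_compl,
      Fintype.card_subtype_eq, hW] at h
    omega
  -- the edge from `a` to `b`, where `b = a` stands for the vertex `o`
  let β : F × Bool → F × Bool → W := fun a b => if b = a then N.o else e b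
  have hβ : ∀ a, Function.Injective (β a) := by
    intro a b b' h
    have hb := (e b).2
    have hb' := (e b').2
    by_cases hba : b = a <;> by_cases hba' : b' = a <;>
      simp only [β, hba, hba', if_true, if_false] at h
    · rw [hba, hba']
    · exact absurd h.symm hb'
    · exact absurd h hb
    · exact e.injective (Subtype.ext h)
  have hβne : ∀ a b, (e a : W) ≠ β a b := by
    intro a b
    by_cases hba : b = a
    · simpa [β, hba] using (e a).2
    · simp only [β, hba, if_false]
      exact fun h => hba (e.injective (Subtype.ext h)).symm
  have hβsurj : ∀ a (w : W), w ≠ e a → ∃ b, β a b = w := by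
    intro a w hw
    by_cases hwo : w = N.o
    · exact ⟨a, by simp [β, hwo]⟩
    · refine ⟨e.symm ⟨w, hwo⟩, ?_⟩
      have : e.symm ⟨w, hwo⟩ ≠ a := by
        rintro rfl
        simp at hw
      simp [β, this]
  let χ : F × Bool → F × Bool → Finset W := fun a b => N.block (e a) (β a b)
  have hdiag : ∀ a, χ a a = N.block (e a) N.o := fun a => by simp [χ, β]
  have hmem : ∀ a b, χ a b ∈ N.blockSet := fun a b => N.mem_blockSet.2 ⟨_, _, hβne a b, rfl⟩
  have hswitch : ∀ f i, χ (f, i) (f, !i) = χ (f, i) (f, i) := by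
    intro f i
    rw [hdiag, ← N.block_op_o (e (f, i)).2]
    simp [χ, β, he]
  have hsymm : ∀ a b, χ a b = χ b a := by
    intro a b
    by_cases hab : a = b
    · rw [hab]
    · simp only [χ, β, hab, Ne.symm hab, if_false]
      exact N.block_comm _ _
  have hχ : IsBaseColouring χ :=
    { symm := hsymm
      ncard_eq_two := by
        intro a b
        rw [← N.ncard_block_eq (hβne a b), ← Set.ncard_image_of_injective _ (hβ a)]
        congr 1
        ext w
        constructor
        · rintro ⟨b', hb', rfl⟩
          exact ⟨(hβne a b').symm, hb'⟩
        · rintro ⟨hw, h⟩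
          obtain ⟨b', rfl⟩ := hβsurj a w hw
          exact ⟨b', h, rfl⟩
      fibre := by
        intro f i j
        have h1 := hswitch f false
        have h2 := hswitch f true
        have h3 := hsymm (f, false) (f, true)
        cases i <;> cases j
        · rfl
        · exact h1
        · exact h3.symm.trans h1
        · exact h2.symm.trans (h3.symm.trans h1)
      fibre_inj := by
        intro a b h
        rw [hdiag, hdiag, N.block_comm, N.block_comm _ N.o,
          N.block_eq_block_iff (e b).2.symm (e a).2.symm] at h
        rcases h with h | ⟨h, -⟩ | ⟨-, h⟩
        · rw [e.injective (Subtype.ext h)]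
        · exact absurd h (N.not_D_o _)
        · have h' : e a = e (b.1, !b.2) := by
            rw [he]
            exact Subtype.ext h
          rw [e.injective h'] }
  have hrange : Set.range (Function.uncurry χ) = N.blockSet := by
    apply subset_antisymm
    · rintro _ ⟨⟨a, b⟩, rfl⟩
      exact hmem a b
    · intro B hB
      obtain ⟨x, y, hxy, rfl⟩ := N.mem_blockSet.1 hB
      have key : ∀ x y, x ≠ y → x ≠ N.o → N.block x y ∈ Set.range (Function.uncurry χ) := by
        intro x y hxy hx
        obtain ⟨b, hb⟩ := hβsurj (e.symm ⟨x, hx⟩) y (by simpa using hxy.symm)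
        refine ⟨(e.symm ⟨x, hx⟩, b), ?_⟩
        simp [χ, hb]
      by_cases hx : x = N.o
      · rw [N.block_comm]
        exact key y x hxy.symm (hx ▸ hxy.symm)
      · exact key x y hxy hx
  refine hχ.mem_spectra_of_coarsening hk hs hF g ?_ ?_ ?_ ?_
  · exact fun a b b' h => hg _ (hmem a b) _ (hmem a b') (e a) (N.left_mem_block _ _)
      (N.left_mem_block _ _) h
  · intro a b h
    refine hg _ (hmem a a) _ (hmem b b) N.o ?_ ?_ h <;> rw [hdiag] <;>
      exact N.right_mem_block _ _
  · refine (Set.ncard_le_card _).trans ?_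
    rwa [Nat.card_eq_fintype_card, Fintype.card_fin]
  · rw [hrange, Set.ncard_coe_finset]
    exact N.le_card_blockSet hs0 hW h2

/-! ### The Bose and Skolem triple systems -/

/-- The third point of the block through two points in Bose's triple system on `R × Fin 3`, where
`h` is the half of `1`. The blocks are `(x, 0), (x, 1), (x, 2)` and
`(x, i), (y, i), ((x + y) / 2, i + 1)` for `x ≠ y`. -/
def boseOp {R : Type} [CommRing R] [DecidableEq R] (h : R) (p q : R × Fin 3) : R × Fin 3 :=
  if p = q then p
  else if p.2 = q.2 then (h * (p.1 + q.1), p.2 + 1)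
  else if q.2 = p.2 + 1 then
    if p.1 = q.1 then (p.1, p.2 + 2) else (2 * q.1 - p.1, p.2)
  else
    if p.1 = q.1 then (p.1, p.2 + 1) else (2 * p.1 - q.1, q.2)

theorem boseOp_comm {R : Type} [CommRing R] [DecidableEq R] (h : R) (p q : R × Fin 3) :
    boseOp h p q = boseOp h q p := by
  obtain ⟨x, i⟩ := p
  obtain ⟨y, j⟩ := q
  by_cases hxy : x = y
  · subst hxy
    fin_cases i <;> fin_cases j <;> simp [boseOp]
  · fin_cases i <;> fin_cases j <;> simp [boseOp, hxy, Ne.symm hxy, add_comm]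

theorem boseOp_boseOp {R : Type} [CommRing R] [DecidableEq R] {h : R} (hh : 2 * h = 1)
    (p q : R × Fin 3) : boseOp h p (boseOp h p q) = q := by
  obtain ⟨x, i⟩ := p
  obtain ⟨y, j⟩ := q
  by_cases hxy : x = y
  · subst hxy
    fin_cases i <;> fin_cases j <;> simp [boseOp]
  · have h1 : x ≠ h * (x + y) := fun h' => hxy (by linear_combination 2 * h' + (x + y) * hh)
    have h2 : 2 * y - x ≠ x := fun h' => hxy (by linear_combination (y - x) * hh - h * h')
    have h3 : 2 * x - y ≠ x := fun h' => hxy (by linear_combination h')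
    have h4 : 2 * (h * (x + y)) - x = y := by linear_combination (x + y) * hh
    have h5 : h * (2 * y) = y := by linear_combination y * hh
    have h6 : 2 * x - (2 * x - y) = y := by ring
    fin_cases i <;> fin_cases j <;>
      simp [boseOp, hxy, h1, h2.symm, h3.symm, h4, h5, h6]

/-- Bose's Steiner triple system of order `6u + 3`. -/
def boseSystem (u : ℕ) : NearSteiner (ZMod (2 * u + 1) × Fin 3) where
  op := boseOp (u + 1 : ZMod (2 * u + 1))
  o := (0, 0)
  D _ _ := False
  op_self p := if_pos rfl
  op_comm := boseOp_comm _
  op_op p q _ := boseOp_boseOp (by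
    have := ZMod.natCast_self (2 * u + 1)
    push_cast at this
    linear_combination this) p q
  not_D_op _ _ := id
  D_symm _ _ := id
  not_D_self _ := id
  not_D_o _ := id
  D_op_o _ _ := False.elim
  D_eq _ _ _ _ := False.elim

theorem eq_sub_add_sub_iff {A : Type*} [AddCommGroup A] {r y : A} :
    r = r - y + (r - y) ↔ r = y + y := by
  rw [← sub_eq_zero, show r - (r - y + (r - y)) = y + y - r by abel, sub_eq_zero, eq_comm]

section Skolem

variable {A : Type} [AddCommGroup A] [DecidableEq A]

/-- The third point of the block through two points in Skolem's triple system on `A × Fin 3` and a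
point at infinity. Here `η` is the only element of order two of the abelian group `A`, `S` is the
indicator of a set of representatives modulo `η`, and `ρ` doubles the elements of `S` and maps the
other ones to non-doubles, so that `ρ⁻¹ (x + y)` is a half-idempotent quasigroup. The
blocks are `(x, 0), (x, 1), (x, 2)` and `∞, (x + η, i), (x, i + 1)` for `x` in `S`, and
`(x, i), (y, i), (ρ⁻¹ (x + y), i + 1)` for `x ≠ y`. -/
def skolemOp (S : A → Bool) (ρ : A ≃ A) (η : A) :
    Option (A × Fin 3) → Option (A × Fin 3) → Option (A × Fin 3)
  | none, none => none
  | none, some q => some (if S q.1 then (q.1 + η, q.2 + 2) else (q.1 + η, q.2 + 1))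
  | some p, none => some (if S p.1 then (p.1 + η, p.2 + 2) else (p.1 + η, p.2 + 1))
  | some p, some q =>
    if p = q then some p
    else if p.2 = q.2 then some (ρ.symm (p.1 + q.1), p.2 + 1)
    else if q.2 = p.2 + 1 then
      if ρ q.1 = p.1 + p.1 then if p.1 = q.1 then some (p.1, p.2 + 2) else none
      else some (ρ q.1 - p.1, p.2)
    else
      if ρ p.1 = q.1 + q.1 then if p.1 = q.1 then some (p.1, p.2 + 1) else none
      else some (ρ p.1 - q.1, q.2)

variable {S : A → Bool} {ρ : A ≃ A} {η : A}

theorem skolemOp_self (p : Option (A × Fin 3)) : skolemOp S ρ η p p = p := by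
  cases p <;> simp [skolemOp]

theorem skolemOp_comm (p q : Option (A × Fin 3)) : skolemOp S ρ η p q = skolemOp S ρ η q p := by
  obtain _ | ⟨x, i⟩ := p <;> obtain _ | ⟨y, j⟩ := q
  · rfl
  · rfl
  · rfl
  by_cases hxy : x = y
  · subst hxy
    fin_cases i <;> fin_cases j <;> simp [skolemOp]
  · fin_cases i <;> fin_cases j <;> simp [skolemOp, hxy, Ne.symm hxy, add_comm]

theorem skolemOp_skolemOp (hη0 : η ≠ 0) (hη : η + η = 0)
    (hdouble : ∀ x y : A, x + x = y + y → x = y ∨ x = y + η) (hS : ∀ x, S (x + η) = !S x)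
    (hρ : ∀ z, S z = true → ρ z = z + z) (hρ' : ∀ z x, S z = false → ρ z ≠ x + x)
    (p q : Option (A × Fin 3)) : skolemOp S ρ η p (skolemOp S ρ η p q) = q := by
  have hηη : ∀ x, x + η + η = x := fun x => by rw [add_assoc, hη, add_zero]
  have hdη : ∀ x : A, x + η + (x + η) = x + x := fun x => by
    rw [add_add_add_comm, hη, add_zero]
  obtain _ | ⟨x, i⟩ := p <;> obtain _ | ⟨y, j⟩ := q
  · rfl
  · by_cases hy : S y = true <;> fin_cases j <;> simp [skolemOp, hy, hS, hηη]
  · by_cases hx : S x = true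
    · have h1 := hρ x hx
      fin_cases i <;> simp [skolemOp, hx, h1, hη0, hdη]
    · have h1 := hρ (x + η) (by simp [hS, hx])
      fin_cases i <;> simp [skolemOp, hx, h1, hη0, hdη]
  by_cases hxy : x = y
  · subst hxy
    by_cases hx : S x = true
    · have h1 := hρ x hx
      fin_cases i <;> fin_cases j <;> simp [skolemOp, h1]
    · have h1 := hρ' x x (by simpa using hx)
      have h2 : x ≠ ρ x - x := fun h => h1 (eq_sub_iff_add_eq.1 h).symm
      have h3 : ¬ ρ x = ρ x - x + (ρ x - x) := fun h => h1 (eq_sub_add_sub_iff.1 h)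
      fin_cases i <;> fin_cases j <;> simp [skolemOp, h1, h2, h3]
  · have hyx : ¬ y = x := Ne.symm hxy
    have key : ∀ a b : A, ¬ a = b → ρ b = a + a → S a = false ∧ a + η = b := by
      intro a b hab h
      have hb : S b = true := by
        by_contra hb
        exact hρ' b a (by simpa using hb) h
      have h' := (hdouble a b (by rw [← h, hρ b hb])).resolve_left hab
      exact ⟨by rw [h', hS, hb]; rfl, by rw [h', hηη]⟩
    have h1' : ¬ ρ y = x + x → x ≠ ρ y - x := fun h1 h => h1 (eq_sub_iff_add_eq.1 h).symm
    have h2' : ¬ ρ x = y + y → ρ x ≠ ρ x - y + (ρ x - y) :=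
      fun h2 h => h2 (eq_sub_add_sub_iff.1 h)
    by_cases h1 : ρ y = x + x <;> by_cases h2 : ρ x = y + y
    · obtain ⟨h3, h4⟩ := key x y hxy h1
      obtain ⟨h5, -⟩ := key y x hyx h2
      rw [← h4, hS, h3] at h5
      exact absurd h5 (by simp)
    · obtain ⟨h3, h4⟩ := key x y hxy h1
      fin_cases i <;> fin_cases j <;> simp [skolemOp, hxy, hyx, h1, h2, h2' h2, h3, h4]
    · obtain ⟨h3, h4⟩ := key y x hyx h2
      have h5 : S x = true := by rw [← h4, hS, h3]; rfl
      have h6 : x + η = y := by rw [← h4, hηη]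
      fin_cases i <;> fin_cases j <;> simp [skolemOp, hxy, hyx, h1, h2, h1' h1, h5, h6]
    · fin_cases i <;> fin_cases j <;> simp [skolemOp, hxy, hyx, h1, h2, h1' h1, h2' h2]

end Skolem

/-- Skolem's Steiner triple system of order `6u + 1`. -/
theorem exists_skolemSystem {u : ℕ} (hu : 0 < u) :
    Nonempty (NearSteiner (Option (ZMod (2 * u) × Fin 3))) := by
  have : NeZero (2 * u) := ⟨by omega⟩
  have hcast : ∀ a b : ℕ, (a : ZMod (2 * u)) = b ↔ a % (2 * u) = b % (2 * u) := fun a b =>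
    ZMod.natCast_eq_natCast_iff' a b (2 * u)
  have h2u : (2 * u : ZMod (2 * u)) = 0 := by exact_mod_cast ZMod.natCast_self (2 * u)
  have hval : ∀ z : ZMod (2 * u), ∃ n < 2 * u, z = (n : ZMod (2 * u)) := fun z =>
    ⟨z.val, z.val_lt, (ZMod.natCast_zmod_val z).symm⟩
  have hvalc : ∀ n < 2 * u, (n : ZMod (2 * u)).val = n := fun n hn => ZMod.val_natCast_of_lt hn
  have hmod2 : ∀ n : ℕ, n % (2 * u) % 2 = n % 2 := fun n => Nat.mod_mod_of_dvd n ⟨u, rfl⟩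
  have hm : ∀ n < 2 * (2 * u), (n < 2 * u ∧ n % (2 * u) = n) ∨
      (2 * u ≤ n ∧ n % (2 * u) = n - 2 * u) := by
    intro n hn
    rcases lt_or_ge n (2 * u) with h | h
    · exact Or.inl ⟨h, Nat.mod_eq_of_lt h⟩
    · exact Or.inr ⟨h, by rw [Nat.mod_eq_sub_mod h, Nat.mod_eq_of_lt (by omega)]⟩
  let S : ZMod (2 * u) → Bool := fun z => decide (z.val < u)
  let ρ : ZMod (2 * u) → ZMod (2 * u) := fun z => if z.val < u then z + z else z + z + 1
  have hinj : Function.Injective ρ := by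
    intro z z' h
    obtain ⟨a, ha, rfl⟩ := hval z
    obtain ⟨b, hb, rfl⟩ := hval z'
    simp only [ρ, hvalc a ha, hvalc b hb] at h
    have ha' := hm (a + a) (by omega)
    have ha'' := hm (a + a + 1) (by omega)
    have hb' := hm (b + b) (by omega)
    have hb'' := hm (b + b + 1) (by omega)
    congr 1
    split_ifs at h <;> norm_cast at h <;> rw [hcast] at h <;> omega
  refine ⟨{ op := skolemOp S (Equiv.ofBijective ρ (Finite.injective_iff_bijective.1 hinj)) u
            o := none
            D := fun _ _ => False
            op_self := skolemOp_self
            op_comm := skolemOp_comm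
            op_op := fun p q _ => skolemOp_skolemOp ?_ ?_ ?_ ?_ ?_ ?_ p q
            not_D_op := fun _ _ => id
            D_symm := fun _ _ => id
            not_D_self := fun _ => id
            not_D_o := fun _ => id
            D_op_o := fun _ _ => False.elim
            D_eq := fun _ _ _ _ => False.elim }⟩
  · rw [Ne, ZMod.natCast_eq_zero_iff]
    intro h
    have := Nat.le_of_dvd hu h
    omega
  · linear_combination h2u
  · intro x y h
    obtain ⟨a, ha, rfl⟩ := hval x
    obtain ⟨b, hb, rfl⟩ := hval y
    rw [← Nat.cast_add, ← Nat.cast_add, hcast] at h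
    have ha' := hm (a + a) (by omega)
    have hb' := hm (b + b) (by omega)
    have : a = b ∨ a = b + u ∨ b = a + u := by omega
    rcases this with rfl | rfl | rfl
    · exact Or.inl rfl
    · exact Or.inr (by push_cast; rfl)
    · refine Or.inr ?_
      push_cast
      linear_combination -h2u
  · intro x
    obtain ⟨a, ha, rfl⟩ := hval x
    have ha' := hm (a + u) (by omega)
    simp only [S, hvalc a ha, ← Nat.cast_add, ZMod.val_natCast]
    rw [← decide_not, decide_eq_decide]
    omega
  · intro z hz
    exact if_pos (by simpa [S] using hz)
  · intro z x hz h
    simp only [Equiv.ofBijective_apply, ρ] at h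
    rw [if_neg (by simpa [S] using hz)] at h
    obtain ⟨a, ha, rfl⟩ := hval x
    obtain ⟨b, hb, rfl⟩ := hval z
    have h' : ((b + b + 1 : ℕ) : ZMod (2 * u)) = (a + a : ℕ) := by
      push_cast
      exact h
    rw [hcast] at h'
    have h3 := hmod2 (b + b + 1)
    have h4 := hmod2 (a + a)
    omega

/-! ### The twisted Bose construction -/

section TwistedBose

variable {R : Type} [CommRing R] [DecidableEq R]

/-- The sign `-1` on the level `2` and `1` on the other ones. -/
def twist (i : Fin 3) : R := if i = 2 then -1 else 1

/-- The third point of the triangle through two points in the twisted Bose construction on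
`R × Fin 3` and two points at infinity, where `h` is the half of `1`. With `ε = twist`, there are
the triangles `(x, i), (y, i), (ε i * (x + y) / 2, i + 1)` for `x ≠ y`. The edges
`(x, i), (ε i * x, i + 1)` that they leave out form hexagons for `x ≠ 0`, on account of the twist;
alternately, these edges are completed to triangles by the two points at infinity, as prescribed
by `σ`, which tells `x` from `-x`. On the remaining five points, the triangles are
`true, false, (0, 0)` and `true, (0, 1), (0, 2)`. The values on the edges of the `4`-cycle left over
are irrelevant. -/
def twistedOp (h : R) (σ : R → Bool) :
    Bool ⊕ (R × Fin 3) → Bool ⊕ (R × Fin 3) → Bool ⊕ (R × Fin 3)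
  | .inl b, .inl b' => if b = b' then .inl b else .inr (0, 0)
  | .inl b, .inr q => inf b q
  | .inr p, .inl b => inf b p
  | .inr p, .inr q =>
    if p = q then .inr p
    else if p.2 = q.2 then .inr (twist p.2 * (h * (p.1 + q.1)), p.2 + 1)
    else if q.2 = p.2 + 1 then up p.1 q.1 p.2
    else up q.1 p.1 q.2
where
  /-- The third point on an edge with one end at infinity. -/
  inf (b : Bool) (q : R × Fin 3) : Bool ⊕ (R × Fin 3) :=
    if q.1 = 0 then
      if q.2 = 0 then .inl (!b) else .inr (0, if q.2 = 1 then 2 else 1)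
    else if xor (σ q.1) (decide (q.2 = 1)) = b then .inr (twist q.2 * q.1, q.2 + 1)
    else .inr (twist (q.2 + 2) * q.1, q.2 + 2)
  /-- The third point on the edge from `(x, i)` to `(z, i + 1)`. -/
  up (x z : R) (i : Fin 3) : Bool ⊕ (R × Fin 3) :=
    if z = twist i * x then
      .inl (if x = 0 then true else xor (σ x) (decide (i = 1)))
    else .inr (2 * twist i * z - x, i)

/-- The edges of the `4`-cycle `false, (0, 1), (0, 0), (0, 2)`. -/
def twistedD (p q : Bool ⊕ (R × Fin 3)) : Prop :=
  ((p = .inl false ∨ p = .inr (0, 0)) ∧ (q = .inr (0, 1) ∨ q = .inr (0, 2))) ∨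
    ((q = .inl false ∨ q = .inr (0, 0)) ∧ (p = .inr (0, 1) ∨ p = .inr (0, 2)))

variable {h : R} {σ : R → Bool}

theorem twistedOp_self (p : Bool ⊕ (R × Fin 3)) : twistedOp h σ p p = p := by
  cases p <;> simp [twistedOp]

theorem twistedOp_comm (p q : Bool ⊕ (R × Fin 3)) : twistedOp h σ p q = twistedOp h σ q p := by
  obtain b | ⟨x, i⟩ := p <;> obtain b' | ⟨y, j⟩ := q
  · cases b <;> cases b' <;> simp [twistedOp]
  · rfl
  · rfl
  by_cases hxy : x = y
  · subst hxy
    fin_cases i <;> fin_cases j <;> simp [twistedOp]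
  · fin_cases i <;> fin_cases j <;> simp [twistedOp, hxy, Ne.symm hxy, add_comm]

theorem twistedOp_twistedOp (hh : 2 * h = 1) (hσ : ∀ x ≠ 0, σ (-x) = !σ x)
    (p q : Bool ⊕ (R × Fin 3)) (hD : ¬ twistedD p q) :
    twistedOp h σ p (twistedOp h σ p q) = q := by
  have hneg : ∀ x : R, -x = x → x = 0 := fun x hx => by linear_combination -h * hx - x * hh
  have hneg' : ∀ x : R, x ≠ 0 → ¬ x = -x := fun x hx h => hx (hneg x h.symm)
  obtain b | ⟨x, i⟩ := p <;> obtain b' | ⟨y, j⟩ := q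
  · cases b <;> cases b' <;> simp [twistedOp, twistedOp.inf]
  · by_cases hy : y = 0
    · subst hy
      cases b <;> fin_cases j <;> simp [twistedOp, twistedOp.inf, twistedD] at hD ⊢
    · cases b <;> cases hs : σ y <;> fin_cases j <;>
        simp [twistedOp, twistedOp.inf, twist, hy, hs, hσ]
  · by_cases hx : x = 0
    · subst hx
      cases b' <;> fin_cases i <;>
        simp [twistedOp, twistedOp.inf, twistedOp.up, twistedD, twist] at hD ⊢
    · cases b' <;> cases hs : σ x <;> fin_cases i <;>
        simp [twistedOp, twistedOp.inf, twistedOp.up, twist, hx, hs, hσ, hneg' x hx]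
  · by_cases hij : i = j
    · subst hij
      by_cases hxy : x = y
      · subst hxy
        simp [twistedOp]
      · have h1 : ¬ h * (x + y) = x := fun h' => hxy (by linear_combination -2 * h' + (x + y) * hh)
        have h4 : 2 * (h * (x + y)) - x = y := by linear_combination (x + y) * hh
        fin_cases i <;> simp [twistedOp, twistedOp.up, twist, hxy, h1, h4]
    · by_cases hup : j = i + 1
      · subst hup
        by_cases hy : y = twist i * x
        · by_cases hx : x = 0
          · subst hx
            obtain rfl : y = 0 := by simpa using hy
            fin_cases i <;> simp [twistedOp, twistedOp.inf, twistedOp.up, twistedD, twist] at hD ⊢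
          · fin_cases i <;> simp [twistedOp, twistedOp.inf, twistedOp.up, twist, hx] at hy ⊢ <;>
              simp [hy, hx]
        · have h1 : ¬ 2 * twist i * y - x = x := fun h' => hy (by
            fin_cases i <;> simp [twist] at h' ⊢
            · linear_combination h * h' + (x - y) * hh
            · linear_combination h * h' + (x - y) * hh
            · linear_combination -h * h' - (x + y) * hh)
          have h5 : h * (2 * y) = y := by linear_combination y * hh
          fin_cases i <;> simp [twist] at hy h1 <;>
            simp [twistedOp, twistedOp.up, twist, hy, Ne.symm h1, h5]
      · obtain rfl : i = j + 1 := by clear hD; revert i j; decide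
        by_cases hx : x = twist j * y
        · by_cases hy : y = 0
          · subst hy
            obtain rfl : x = 0 := by simpa using hx
            fin_cases j <;> simp [twistedOp, twistedOp.inf, twistedOp.up, twistedD, twist] at hD ⊢
          · subst hx
            cases hs : σ y <;> fin_cases j <;>
              simp [twistedOp, twistedOp.inf, twistedOp.up, twist, hy, hs, hσ]
        · have h1 : ¬ x = twist j * (2 * twist j * x - y) := fun h' => hx (by
            fin_cases j <;> simp [twist] at h' ⊢ <;> linear_combination -h')
          fin_cases j <;> simp [twist] at hx h1 <;>
            simp [twistedOp, twistedOp.up, twist, hx, h1]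

/-- The twisted Bose construction; for `|R| = 2u + 1` the order is `6u + 5`. -/
def twistedBoseSystem (hh : 2 * h = 1) (hσ : ∀ x ≠ 0, σ (-x) = !σ x) :
    NearSteiner (Bool ⊕ (R × Fin 3)) where
  op := twistedOp h σ
  o := .inl true
  D := twistedD
  op_self := twistedOp_self
  op_comm := twistedOp_comm
  op_op := twistedOp_twistedOp hh hσ
  not_D_op p q hD hD' := by
    -- the third point `r` on `p q` determines `q`, which leaves the eight pairs `p r` to be checked
    have hq := twistedOp_twistedOp hh hσ p q hD
    generalize hr : twistedOp h σ p q = r at hD' hq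
    rcases hD' with ⟨rfl | rfl, rfl | rfl⟩ | ⟨rfl | rfl, rfl | rfl⟩ <;>
      simp [twistedOp, twistedOp.inf, twistedOp.up, twist] at hq <;> subst hq <;>
      simp [twistedOp, twistedOp.inf, twistedOp.up, twist, twistedD] at hr hD
  D_symm p q h := h.symm
  not_D_self p h := by
    rcases h with ⟨rfl | rfl, h | h⟩ | ⟨rfl | rfl, h | h⟩ <;> simp at h
  not_D_o p h := by simp [twistedD] at h
  D_op_o p q h := by
    rcases h with ⟨h, rfl | rfl⟩ | ⟨rfl | rfl, h⟩ <;> simp [twistedD, twistedOp, twistedOp.inf, h]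
  D_eq p q p' q' hpq hpq' := by
    have key : ∀ p q : Bool ⊕ (R × Fin 3), twistedD p q →
        ({p, q, twistedOp h σ (.inl true) p, twistedOp h σ (.inl true) q} : Set _) =
          {.inl false, .inr (0, 0), .inr (0, 1), .inr (0, 2)} := by
      intro p q hD
      rcases hD with ⟨rfl | rfl, rfl | rfl⟩ | ⟨rfl | rfl, rfl | rfl⟩ <;>
        simp [twistedOp, twistedOp.inf] <;> ext <;> simp <;> tauto
    rw [key _ _ hpq, key _ _ hpq']

end TwistedBose

theorem exists_twistedBoseSystem (u : ℕ) :
    Nonempty (NearSteiner (Bool ⊕ (ZMod (2 * u + 1) × Fin 3))) := by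
  refine ⟨twistedBoseSystem (h := (u + 1 : ZMod (2 * u + 1))) (σ := fun x => decide (x.val ≤ u))
    ?_ ?_⟩
  · have := ZMod.natCast_self (2 * u + 1)
    push_cast at this
    linear_combination this
  · intro x hx
    have : NeZero x := ⟨hx⟩
    have h1 := ZMod.val_neg_of_ne_zero x
    have h2 := x.val_lt
    rw [h1, ← decide_not, decide_eq_decide]
    omega

/-- The complete graph on `2s + 1` vertices has a decomposition into triangles and at most one
`4`-cycle. -/
theorem exists_nearSteiner {s : ℕ} (hs : 0 < s) :
    ∃ (W : Type) (_ : Fintype W), Fintype.card W = 2 * s + 1 ∧ Nonempty (NearSteiner W) := by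
  obtain ⟨u, hu⟩ : ∃ u, s = 3 * u ∨ s = 3 * u + 1 ∨ s = 3 * u + 2 := ⟨s / 3, by omega⟩
  rcases hu with rfl | rfl | rfl
  · have : NeZero (2 * u) := ⟨by omega⟩
    refine ⟨Option (ZMod (2 * u) × Fin 3), inferInstance, ?_, exists_skolemSystem (by omega)⟩
    simp [ZMod.card]
    ring
  · refine ⟨ZMod (2 * u + 1) × Fin 3, inferInstance, ?_, ⟨boseSystem u⟩⟩
    simp [ZMod.card]
    ring
  · refine ⟨Bool ⊕ (ZMod (2 * u + 1) × Fin 3), inferInstance, ?_, exists_twistedBoseSystem u⟩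
    simp [ZMod.card]
    ring

/-! ### The spectrum -/

theorem theorem1 (k s : ℕ) (hk : 0 < k) (hs : s ∣ k) (c : ℕ)
    (hsc : s ≤ c) (hc : c ≤ (2 * s ^ 2 + s) / 3) :
    c ∈ orderColourSpectrum s (1 + 8 * k) ∧ c ∈ orderEquitableSpectrum k s := by
  have hs0 : 0 < s := Nat.pos_of_dvd_of_pos hs hk
  rcases hsc.eq_or_lt with rfl | hlt
  · exact self_mem_spectra hk hs
  rcases le_or_gt c ((s + 1).choose 2) with hle | hgt
  · exact mem_spectra_of_lt_of_le_choose hk hs hlt hle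
  obtain ⟨W, _, hW, ⟨N⟩⟩ := exists_nearSteiner hs0
  refine N.mem_spectra hk hs hW ?_ hc
  have h2 : 2 * (s + 1).choose 2 = s * (s + 1) := by
    rw [Nat.choose_two_right, Nat.add_sub_cancel, mul_comm (s + 1),
      Nat.mul_div_cancel' (Nat.even_mul_succ_self s).two_dvd]
  -- this says that `(s - 2) (s - 3) ≥ 0`
  have h3 : 6 * s ≤ s * (s + 1) + 6 := by
    rcases le_or_gt s 3 with h | h
    · interval_cases s <;> omega
    · nlinarith
  omega
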